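/- Let $n\ge 0$ and $N\ge n+1$ be integers and let $|\cdot|$ be the Euclidean norm. Let $h:\mathbb{R}^n\to\mathbb{R}$ be differentiable, and suppose that for some constants $\omega,\vartheta>0$ and all $x,y\in\mathbb{R}^n$ $$(x-y)^T(\nabla h(x)-\nabla h(y))\ge\omega|x-y|^2,\qquad |\nabla h(x)-\nabla h(y)|\le\vartheta|x-y|,$$ and that the minimizer of $h$ is $0$ (a normalization). Consider $N$ agents $\dot p_i=v_i$ with positions $p_i\in\mathbb{R}^n$, average position $p_0=\frac1N\sum_{i=1}^N p_i$, and control law $v_i=v_i^f+v_i^e$, where $$v_i^f=-\frac1N\sum_{j=1}^N a_{ij}(p_i-p_j-d_{ij}),\qquad v_i^e=-c_0\,\sigma\Big(\Big(\sum_{j=1}^N d_{j0}d_{j0}^T\Big)^{-1}\delta_i\Big),\qquad d_{j0}=\frac1N\sum_{i=1}^N d_{ji},$$ $$\dot\delta_i=-(\delta_i-Nd_{i0}h(p_i))-\sum_{j=1}^N b_{ij}(q_i-q_j),\qquad \dot q_i=\mu\sum_{j=1}^N b_{ij}(\delta_i-\delta_j).$$ Let $(a_{ij})$ and $(b_{ij})$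 be nonnegative symmetric weights, each of which defines a connected graph on the agents (an edge joins $i\ne j$ when the weight is nonzero). Let $\sigma:\mathbb{R}^n\to\mathbb{R}^n$ be bounded and locally Lipschitz with $\sigma(0)=0$, with $r^T\sigma(r)>0$ for $r\ne0$, and such that for some $\kappa>0$ and $R$ one has $r^T\sigma(r)\ge\kappa|r||\sigma(r)|$ whenever $|r|\ge R$ (for example $\sigma(r)=\min\{1,1/|r|\}\,r$). Then for every $p_\epsilon>0$ there are vectors $d_{ij}\in\mathbb{R}^n$ with $d_{ij}=-d_{ji}$, $d_{ij}+d_{jk}=d_{ik}$ and $\det\big(\sum_j d_{j0}d_{j0}^T\big)>0$, and constants $c_0,\mu>0$, such that the following holds. From every initial state the closed-loop system has a solution on $[0,\infty)$; and along every solution on $[0,\infty)$ all the states $p_i,\delta_i,q_i$ are bounded, and there is $T\geq 0$ such that $|p_0(t)|\le p_\epsilon$ for all $t\ge T$. -/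

import Mathlib

noncomputable section

namespace SourceSeeking

/-- `ℝⁿ` with the Euclidean norm. -/
abbrev Vec (n : ℕ) : Type := EuclideanSpace ℝ (Fin n)

/-- Strong monotonicity of the gradient with constant `ω`, Lipschitz continuity of the gradient
with constant `ϑ`, and the normalization that the minimizer of the objective function is `0`. -/
structure IsObjective {n : ℕ} (h : Vec n → ℝ) (ω ϑ : ℝ) : Prop where
  differentiable : Differentiable ℝ h
  omega_pos : 0 < ω
  theta_pos : 0 < ϑ
  strong_convexity : ∀ p₁ p₂ : Vec n,
    ω * ‖p₁ - p₂‖ ^ 2 ≤ inner ℝ (p₁ - p₂) (gradient h p₁ - gradient h p₂)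
  lipschitz_gradient : ∀ p₁ p₂ : Vec n,
    ‖gradient h p₁ - gradient h p₂‖ ≤ ϑ * ‖p₁ - p₂‖
  minimizer : ∀ p : Vec n, h 0 ≤ h p

/-- Coupling weights of an undirected connected network of `N` agents: nonnegative, symmetric,
and such that the graph of the pairs of distinct agents with nonzero weight is connected. -/
structure IsConnectedWeight {N : ℕ} (a : Fin N → Fin N → ℝ) : Prop where
  nonneg : ∀ i j, 0 ≤ a i j
  symm : ∀ i j, a i j = a j i
  connected : (SimpleGraph.fromRel fun i j => a i j ≠ 0).Connected

/-- Saturation functions: bounded and locally Lipschitz, zero at `0`, with `rᵀ σ(r) > 0` for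
`r ≠ 0`, and such that the angle between `r` and `σ(r)` stays away from a right angle
as `|r| → ∞`. -/
structure IsSaturation {n : ℕ} (σ : Vec n → Vec n) : Prop where
  locallyLipschitz : LocallyLipschitz σ
  bounded : ∃ S : ℝ, ∀ r, ‖σ r‖ ≤ S
  map_zero : σ 0 = 0
  inner_pos : ∀ r, r ≠ 0 → 0 < inner ℝ r (σ r)
  angle : ∃ κ > 0, ∃ R : ℝ, ∀ r, R ≤ ‖r‖ → κ * (‖r‖ * ‖σ r‖) ≤ inner ℝ r (σ r)

/-- `d_{i0} = (1/N) ∑ⱼ d_{ij}`: the desired position of agent `i` relative to the average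
position. -/
def relCenter {n N : ℕ} (d : Fin N → Fin N → Vec n) (i : Fin N) : Vec n :=
  (N : ℝ)⁻¹ • ∑ j, d i j

/-- The matrix `∑ⱼ d_{j0} d_{j0}ᵀ`. -/
def formationMatrix {n N : ℕ} (d : Fin N → Fin N → Vec n) : Matrix (Fin n) (Fin n) ℝ :=
  ∑ j, Matrix.vecMulVec (relCenter d j).ofLp (relCenter d j).ofLp

/-- Desired relative positions `d_{ij}` (of agent `i` with respect to agent `j`): they are those
of an actual configuration of points, and the formation is nondegenerate. -/
structure IsFormation {n N : ℕ} (d : Fin N → Fin N → Vec n) : Prop where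
  antisymm : ∀ i j, d i j = -d j i
  consistent : ∀ i j k, d i j + d j k = d i k
  det_pos : 0 < (formationMatrix d).det

/-- The parameters of the distributed controllers. -/
structure Controller (n N : ℕ) where
  a : Fin N → Fin N → ℝ
  b : Fin N → Fin N → ℝ
  d : Fin N → Fin N → Vec n
  σ : Vec n → Vec n
  c₀ : ℝ
  μ : ℝ

namespace Controller

variable {n N : ℕ} (C : Controller n N)

/-- Formation control part `v_i^f` of the velocity. -/
def formationVelocity (p : Fin N → Vec n) (i : Fin N) : Vec n :=
  -((N : ℝ)⁻¹ • ∑ j, C.a i j • (p i - p j - C.d i j))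

/-- Source-seeking part `v_i^e` of the velocity. -/
def seekingVelocity (δ : Fin N → Vec n) (i : Fin N) : Vec n :=
  -(C.c₀ • C.σ (WithLp.toLp 2 (Matrix.mulVec (formationMatrix C.d)⁻¹ (δ i).ofLp)))

/-- Right-hand side of the equation for `δ_i` in the distributed averaging algorithm. -/
def deltaRate (h : Vec n → ℝ) (p δ q : Fin N → Vec n) (i : Fin N) : Vec n :=
  -(δ i - ((N : ℝ) * h (p i)) • relCenter C.d i) - ∑ j, C.b i j • (q i - q j)

/-- Right-hand side of the equation for `q_i` in the distributed averaging algorithm. -/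
def qRate (δ : Fin N → Vec n) (i : Fin N) : Vec n :=
  C.μ • ∑ j, C.b i j • (δ i - δ j)

/-- `(p, δ, q)` is a solution on `[0, ∞)` of the closed-loop system (the derivative at `t = 0` is
one-sided). -/
structure IsSolution (h : Vec n → ℝ) (p δ q : ℝ → Fin N → Vec n) : Prop where
  position : ∀ t, 0 ≤ t → ∀ i,
    HasDerivWithinAt (fun s => p s i)
      (C.seekingVelocity (δ t) i + C.formationVelocity (p t) i) (Set.Ici 0) t
  delta : ∀ t, 0 ≤ t → ∀ i,
    HasDerivWithinAt (fun s => δ s i) (C.deltaRate h (p t) (δ t) (q t) i) (Set.Ici 0) t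
  q : ∀ t, 0 ≤ t → ∀ i,
    HasDerivWithinAt (fun s => q s i) (C.qRate (δ t) i) (Set.Ici 0) t

end Controller

/-- The average position `p₀ = (1/N) ∑ᵢ pᵢ`. -/
def averagePosition {n N : ℕ} (p : Fin N → Vec n) : Vec n :=
  (N : ℝ)⁻¹ • ∑ i, p i

end SourceSeeking

end

/-! Take `d i j = ε • (e i - e j)` for a centered frame `e` with `∑ eᵢ eᵢᵀ = 1`, and gains `c₀ =
ε²`, `μ = 1`. The moment matrix is then `ε² • 1`, so agent `i` moves along `-ε² σ(ε⁻² δᵢ)` plus the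
formation term. Everything reduces to showing that `ε⁻² δᵢ` eventually approximates `∇h(p₀)` with
small relative error away from the origin.

Since `σ` is bounded, the drive is `O(ε²)`, so the disagreement of the `pᵢ - ε eᵢ` and all
velocities are eventually `O(ε²)` (`eventually_spread_le`). A Taylor expansion at `p₀` then shows
that the average of the inputs `N h(pᵢ) ε eᵢ` is `ε² (∇h(p₀) + O(ε)(|p₀| + 1))`: the constant term
cancels because `e` is centered, and the linear term is the gradient by the frame identity. The
inputs change at rate `O(ε³)(|p₀| + 1)`, so the averaging algorithm tracks their average within
`O(ε³)(|p₀| + 1)` (`eventually_tracking_le`). Together this gives `ε⁻² δᵢ = ∇h(p₀) + O(ε)(|p₀| + 1)`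
(`eventually_estimate_le`). No bound on `p₀` is known at this stage, which is why all errors are
relative to `|p₀| + 1`.

Outside a ball of radius `ρ`, `|∇h(p₀)| ≥ ω |p₀|` makes this a relative error of size `O(ε)`. The
angle condition on `σ` then makes every agent's seeking term a descent direction, so `h(p₀) - h(0)`
is a Lyapunov function for the average (`eventually_mean_le`, `exists_scale`).

Existence for all times is separate: saturation bounds the growth of `p` independently of `δ` and
`q`, after which `(δ, q)` solves a linear system with bounded forcing. -/

noncomputable section

namespace SourceSeeking

open Set Filter Topology Metric NNReal

/-! ### Global solutions of locally Lipschitz autonomous equations from a priori bounds. -/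

section GlobalExistence

theorem locallyLipschitz_smul {X E' : Type*} [PseudoEMetricSpace X] [NormedAddCommGroup E'] [NormedSpace ℝ E']
    {f : X → ℝ} {g : X → E'} (hf : LocallyLipschitz f) (hg : LocallyLipschitz g) :
    LocallyLipschitz fun x => f x • g x := by
  have h : LocallyLipschitz fun p : ℝ × E' => p.1 • p.2 :=
    (contDiff_smul (𝕜 := ℝ) (n := 1)).locallyLipschitz
  exact h.comp (hf.prodMk hg)

variable {E : Type*} [NormedAddCommGroup E] [NormedSpace ℝ E] [FiniteDimensional ℝ E]

/-- A bounded locally Lipschitz autonomous vector field has solutions on every compact interval. -/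
theorem exists_solution_Icc_of_bounded {F : E → E} (hF : LocallyLipschitz F) {C : ℝ≥0}
    (hC : ∀ x, ‖F x‖ ≤ C) (x₀ : E) {T : ℝ} (hT : 0 ≤ T) :
    ∃ α : ℝ → E, α 0 = x₀ ∧ ∀ t ∈ Icc 0 T, HasDerivWithinAt α (F (α t)) (Icc 0 T) t := by
  have : ProperSpace E := FiniteDimensional.proper ℝ E
  obtain ⟨K, hK⟩ := (hF.locallyLipschitzOn (s := closedBall x₀ (C * T.toNNReal : ℝ≥0)))
    |>.exists_lipschitzOnWith_of_compact (isCompact_closedBall _ _)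
  have hP : IsPicardLindelof (fun _ => F) (⟨0, le_rfl, hT⟩ : Icc (0 : ℝ) T) x₀
      (C * T.toNNReal) 0 C K := by
    refine .of_time_independent (fun x _ => hC x) hK ?_
    simp [hT]
  exact hP.exists_eq_forall_mem_Icc_hasDerivWithinAt₀

/-- A locally Lipschitz autonomous vector field has a solution on `[0, T]` if solutions obey an
a priori bound. -/
theorem exists_solution_Icc {F : E → E} (hF : LocallyLipschitz F) (x₀ : E) {T : ℝ} (hT : 0 ≤ T)
    {R : ℝ} (hR : ∀ τ, 0 ≤ τ → τ ≤ T → ∀ α : ℝ → E, α 0 = x₀ →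
      (∀ t ∈ Icc 0 τ, HasDerivWithinAt α (F (α t)) (Icc 0 τ) t) → ‖α τ‖ ≤ R) :
    ∃ α : ℝ → E, α 0 = x₀ ∧ ∀ t ∈ Icc 0 T, HasDerivWithinAt α (F (α t)) (Icc 0 T) t := by
  have : ProperSpace E := FiniteDimensional.proper ℝ E
  -- The cut-off field is bounded and agrees with `F` on the ball of radius `R + 1`; the margin 1
  -- over `R` makes the first exit contradictory.
  set χ : E → ℝ := fun x => max 0 (min 1 (R + 2 - ‖x‖)) with hχ
  have hχL : LocallyLipschitz χ := by
    have h1 : LocallyLipschitz fun x : E => R + 2 - ‖x‖ := by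
      have h2 : LocallyLipschitz fun x : E => ‖x‖ := lipschitzWith_one_norm.locallyLipschitz
      have h3 := (LocallyLipschitz.const (α := E) (R + 2)).add h2.neg
      simpa [sub_eq_add_neg] using h3
    exact (h1.const_min 1).const_max 0
  have hχ1 : ∀ x, ‖x‖ ≤ R + 1 → χ x = 1 := by
    intro x hx
    have : (1 : ℝ) ≤ R + 2 - ‖x‖ := by linarith
    simp [hχ, min_eq_left this]
  have hχ0 : ∀ x, R + 2 ≤ ‖x‖ → χ x = 0 := by
    intro x hx
    have : R + 2 - ‖x‖ ≤ 0 := by linarith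
    simp [hχ, this]
  have hχle : ∀ x, |χ x| ≤ 1 := by
    intro x
    rw [abs_of_nonneg (le_max_left _ _)]
    exact max_le zero_le_one (min_le_left _ _)
  obtain ⟨C, hC⟩ := (isCompact_closedBall (0 : E) (R + 2)).exists_bound_of_continuousOn
    hF.continuous.continuousOn
  have hbd : ∀ x, ‖χ x • F x‖ ≤ C.toNNReal := by
    intro x
    rw [norm_smul, Real.norm_eq_abs]
    rcases le_total (R + 2) ‖x‖ with h | h
    · simp [hχ0 x h]
    · calc |χ x| * ‖F x‖ ≤ 1 * ‖F x‖ := by gcongr; exact hχle x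
        _ ≤ C := by simpa using hC x (by simpa using h)
        _ ≤ _ := Real.le_coe_toNNReal C
  obtain ⟨α, hα0, hα⟩ := exists_solution_Icc_of_bounded (locallyLipschitz_smul hχL hF) hbd x₀ hT
  have hcont : ContinuousOn α (Icc 0 T) := fun t ht => (hα t ht).continuousWithinAt
  -- a solution of the cut-off equation solves the original one up to the first exit time
  have key : ∀ τ, 0 ≤ τ → τ ≤ T → (∀ t ∈ Icc 0 τ, ‖α t‖ ≤ R + 1) → ‖α τ‖ ≤ R := by
    intro τ h0 h1 h2
    refine hR τ h0 h1 α hα0 fun t ht => ?_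
    have h3 := (hα t ⟨ht.1, ht.2.trans h1⟩).mono (Icc_subset_Icc_right h1)
    simpa [hχ1 _ (h2 t ht)] using h3
  have hin : ∀ t ∈ Icc 0 T, ‖α t‖ ≤ R + 1 := by
    by_contra! hcon
    obtain ⟨s, hs, hsR⟩ := hcon
    have hx0 : ‖x₀‖ ≤ R := by
      have := hR 0 le_rfl hT (fun _ => x₀) rfl (by
        intro t ht
        rw [Icc_self]
        have : t = 0 := by simpa using ht
        subst this
        exact hasDerivWithinAt_iff_hasFDerivWithinAt.2 .singleton)
      simpa using this
    set A : Set ℝ := Icc 0 T ∩ (fun t => ‖α t‖) ⁻¹' Ici (R + 1) with hA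
    have hAc : IsCompact A := isCompact_Icc.of_isClosed_subset
      (hcont.norm.preimage_isClosed_of_isClosed isClosed_Icc isClosed_Ici) inter_subset_left
    obtain ⟨τ, hτ, hmin⟩ := hAc.exists_isLeast ⟨s, hs, hsR.le⟩
    have h1 : ∀ t ∈ Ico 0 τ, ‖α t‖ ≤ R + 1 := by
      intro t ht
      by_contra! h2
      exact absurd (hmin ⟨⟨ht.1, ht.2.le.trans hτ.1.2⟩, h2.le⟩) (not_le.2 ht.2)
    have hτ0 : 0 < τ := by
      rcases hτ.1.1.eq_or_lt with h2 | h2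
      · exfalso
        have := hτ.2
        rw [← h2] at this
        simp only [mem_preimage, mem_Ici, hα0] at this
        linarith
      · exact h2
    have hclos : ‖α τ‖ ≤ R + 1 := by
      have h3 : ContinuousWithinAt (fun t => ‖α t‖) (Ico 0 τ) τ :=
        ((hcont τ hτ.1).norm).mono fun t ht => ⟨ht.1, ht.2.le.trans hτ.1.2⟩
      have h4 : τ ∈ closure (Ico 0 τ) := by
        rw [closure_Ico hτ0.ne]
        exact ⟨hτ0.le, le_rfl⟩
      have : (𝓝[Ico 0 τ] τ).NeBot := mem_closure_iff_nhdsWithin_neBot.1 h4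
      exact le_of_tendsto h3 (eventually_mem_nhdsWithin.mono fun t ht => h1 t ht)
    have h5 := key τ hτ.1.1 hτ.1.2 (by
      intro t ht
      rcases ht.2.eq_or_lt with h | h
      · rw [h]; exact hclos
      · exact h1 t ⟨ht.1, h⟩)
    have h6 : R + 1 ≤ ‖α τ‖ := hτ.2
    linarith
  refine ⟨α, hα0, fun t ht => ?_⟩
  simpa [hχ1 _ (hin t ht)] using hα t ht

/-- Solutions on all compact intervals `[0, T]` yield a solution on `[0, ∞)`. -/
theorem exists_solution_Ici {F : E → E} (hF : LocallyLipschitz F) (x₀ : E)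
    (hex : ∀ T, 0 ≤ T → ∃ α : ℝ → E, α 0 = x₀ ∧
      ∀ t ∈ Icc 0 T, HasDerivWithinAt α (F (α t)) (Icc 0 T) t) :
    ∃ α : ℝ → E, α 0 = x₀ ∧ ∀ t, 0 ≤ t → HasDerivWithinAt α (F (α t)) (Ici 0) t := by
  have : ProperSpace E := FiniteDimensional.proper ℝ E
  choose β hβ0 hβ using fun k : ℕ => hex (k + 1) (by positivity)
  have hcont : ∀ k, ContinuousOn (β k) (Icc 0 ((k : ℝ) + 1)) :=
    fun k t ht => (hβ k t ht).continuousWithinAt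
  have huniq : ∀ j k : ℕ, ∀ s : ℝ, 0 ≤ s → s ≤ j + 1 → s ≤ k + 1 → β j s = β k s := by
    intro j k s hs hj hk
    have hmem : ∀ i : ℕ, s ≤ i + 1 → ∃ C, ∀ t ∈ Icc 0 s, β i t ∈ closedBall (0 : E) C := by
      intro i hi
      obtain ⟨C, hC⟩ := isCompact_Icc.exists_bound_of_continuousOn
        ((hcont i).mono (Icc_subset_Icc_right hi))
      exact ⟨C, fun t ht => by simpa using hC t ht⟩
    obtain ⟨Cj, hCj⟩ := hmem j hj
    obtain ⟨Ck, hCk⟩ := hmem k hk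
    -- Both solutions stay in one compact ball, where `F` is Lipschitz and uniqueness applies.
    obtain ⟨K, hK⟩ := (hF.locallyLipschitzOn (s := closedBall (0 : E) (max Cj Ck)))
      |>.exists_lipschitzOnWith_of_compact (isCompact_closedBall _ _)
    have hd : ∀ i : ℕ, s ≤ i + 1 → ∀ t ∈ Ico 0 s,
        HasDerivWithinAt (β i) (F (β i t)) (Ici t) t := by
      intro i hi t ht
      refine (hβ i t ⟨ht.1, (ht.2.trans_le hi).le⟩).mono_of_mem_nhdsWithin ?_
      exact mem_of_superset (Icc_mem_nhdsGE (ht.2.trans_le hi)) (Icc_subset_Icc_left ht.1)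
    exact ODE_solution_unique_of_mem_Icc_right (v := fun _ => F)
      (s := fun _ => closedBall (0 : E) (max Cj Ck)) (fun _ _ => hK)
      ((hcont j).mono (Icc_subset_Icc_right hj)) (hd j hj)
      (fun t ht => closedBall_subset_closedBall (le_max_left _ _) (hCj t ⟨ht.1, ht.2.le⟩))
      ((hcont k).mono (Icc_subset_Icc_right hk)) (hd k hk)
      (fun t ht => closedBall_subset_closedBall (le_max_right _ _) (hCk t ⟨ht.1, ht.2.le⟩))
      ((hβ0 j).trans (hβ0 k).symm) ⟨hs, le_rfl⟩
  -- `β k` lives on `[0, k + 1]`, so `β ⌊t⌋₊` is still a solution slightly beyond `t`.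
  refine ⟨fun t => β ⌊t⌋₊ t, by simp [hβ0], fun t ht => ?_⟩
  have hlt := Nat.lt_floor_add_one t
  have h1 : HasDerivWithinAt (β ⌊t⌋₊) (F (β ⌊t⌋₊ t)) (Ici 0) t :=
    (hβ ⌊t⌋₊ t ⟨ht, hlt.le⟩).mono_of_mem_nhdsWithin
      (by
        rw [← Ici_inter_Iic]
        exact inter_mem self_mem_nhdsWithin (mem_nhdsWithin_of_mem_nhds (Iic_mem_nhds hlt)))
  refine h1.congr_of_eventuallyEq ?_ rfl
  filter_upwards [self_mem_nhdsWithin, mem_nhdsWithin_of_mem_nhds (Iio_mem_nhds hlt)] with s hs hs'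
  exact huniq _ _ s hs (Nat.lt_floor_add_one s).le hs'.le

end GlobalExistence

/-! ### Scalar differential inequalities for large times. -/

section Comparison

/-- A scalar function with `X' ≤ -lam X` eventually drops below every positive level. -/
theorem eventually_le_of_deriv_le_neg_mul {X X' : ℝ → ℝ} {lam : ℝ} (hlam : 0 < lam)
    (hd : ∀ᶠ t in atTop, HasDerivAt X (X' t) t) (hle : ∀ᶠ t in atTop, X' t ≤ -lam * X t)
    {η : ℝ} (hη : 0 < η) : ∀ᶠ t in atTop, X t ≤ η := by
  obtain ⟨T, hT⟩ := eventually_atTop.1 (hd.and hle)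
  have hg : ∀ t ≥ T, HasDerivAt (fun t => X t * Real.exp (lam * t))
      (X' t * Real.exp (lam * t) + X t * (Real.exp (lam * t) * lam)) t := by
    intro t ht
    refine (hT t ht).1.mul ?_
    simpa using ((hasDerivAt_id t).const_mul lam).exp
  have hanti : AntitoneOn (fun t => X t * Real.exp (lam * t)) (Ici T) := by
    refine antitoneOn_of_deriv_nonpos (convex_Ici T)
      (fun t ht => (hg t ht).continuousAt.continuousWithinAt) ?_ ?_
    · rw [interior_Ici]
      exact fun t ht => (hg t (mem_Ioi.1 ht).le).differentiableAt.differentiableWithinAt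
    · rw [interior_Ici]
      intro t ht
      rw [(hg t (mem_Ioi.1 ht).le).deriv]
      have := (hT t (mem_Ioi.1 ht).le).2
      have h0 := Real.exp_pos (lam * t)
      nlinarith
  have hlim : Tendsto (fun t => (X T * Real.exp (lam * T)) * Real.exp (-(lam * t))) atTop (𝓝 0) := by
    have h1 : Tendsto (fun t : ℝ => lam * t) atTop atTop := tendsto_id.const_mul_atTop hlam
    simpa using (Real.tendsto_exp_neg_atTop_nhds_zero.comp h1).const_mul (X T * Real.exp (lam * T))
  filter_upwards [hlim.eventually (gt_mem_nhds hη), eventually_ge_atTop T] with t h1 h2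
  have h3 : X t * Real.exp (lam * t) ≤ X T * Real.exp (lam * T) := hanti self_mem_Ici h2 h2
  have h4 : X t = X t * Real.exp (lam * t) * Real.exp (-(lam * t)) := by
    rw [mul_assoc, ← Real.exp_add]; simp
  rw [h4]
  exact (mul_le_mul_of_nonneg_right h3 (Real.exp_pos _).le).trans h1.le

/-- A function that does not increase while above the level `v₀` stays below the maximum of `v₀`
and its initial value. -/
theorem le_max_of_deriv_nonpos_above {V V' : ℝ → ℝ} {T v₀ : ℝ}
    (hd : ∀ t ≥ T, HasDerivAt V (V' t) t) (hle : ∀ t ≥ T, v₀ < V t → V' t ≤ 0)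
    {t : ℝ} (ht : T ≤ t) : V t ≤ max (V T) v₀ := by
  by_contra! hcon
  have hcont : ContinuousOn V (Icc T t) := fun s hs =>
    (hd s hs.1).continuousAt.continuousWithinAt
  have hAc : IsCompact (Icc T t ∩ V ⁻¹' Iic (max (V T) v₀)) := isCompact_Icc.of_isClosed_subset
    (hcont.preimage_isClosed_of_isClosed isClosed_Icc isClosed_Iic) inter_subset_left
  -- `s` is the last time before `t` at which the bound holds; after it `V` exceeds `v₀`, hence
  -- cannot increase.
  obtain ⟨s, hs, hmax⟩ := hAc.exists_isGreatest ⟨T, ⟨le_rfl, ht⟩, le_max_left (V T) v₀⟩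
  have habove : ∀ r ∈ Ioc s t, max (V T) v₀ < V r := by
    intro r hr
    by_contra! h
    exact absurd (hmax ⟨⟨hs.1.1.trans hr.1.le, hr.2⟩, h⟩) (not_le.2 hr.1)
  have hanti : AntitoneOn V (Icc s t) := by
    refine antitoneOn_of_deriv_nonpos (convex_Icc s t)
      (hcont.mono (Icc_subset_Icc_left hs.1.1)) ?_ ?_
    · rw [interior_Icc]
      exact fun r hr =>
        (hd r (hs.1.1.trans hr.1.le)).differentiableAt.differentiableWithinAt
    · rw [interior_Icc]
      intro r hr
      rw [(hd r (hs.1.1.trans hr.1.le)).deriv]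
      exact hle r (hs.1.1.trans hr.1.le)
        ((le_max_right _ _).trans_lt (habove r ⟨hr.1, hr.2.le⟩))
  have h1 : V t ≤ V s := hanti ⟨le_rfl, hs.1.2⟩ ⟨hs.1.2, le_rfl⟩ hs.1.2
  have h2 : V s ≤ max (V T) v₀ := hs.2
  linarith

/-- A function that decreases at least at a fixed rate while above the level `v₀` is eventually
at most `v₀`. -/
theorem eventually_le_of_deriv_neg_above {V V' : ℝ → ℝ} {v₀ m : ℝ} (hm : 0 < m)
    (hd : ∀ᶠ t in atTop, HasDerivAt V (V' t) t)
    (hle : ∀ᶠ t in atTop, v₀ < V t → V' t ≤ -m) : ∀ᶠ t in atTop, V t ≤ v₀ := by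
  obtain ⟨T, hT⟩ := eventually_atTop.1 (hd.and hle)
  have hex : ∃ t ≥ T, V t ≤ v₀ := by
    by_contra! hcon
    -- If `V` never reached `v₀`, then `V + m t` would be nonincreasing, which fails after time `(V
    -- T - v₀) / m`.
    have hW : ∀ t ≥ T, HasDerivAt (fun t => V t + m * t) (V' t + m) t := fun t ht =>
      ((hT t ht).1.add ((hasDerivAt_id t).const_mul m)).congr_deriv (by simp)
    set t := T + max 0 ((V T - v₀) / m) with htdef
    have ht : T ≤ t := by rw [htdef]; linarith [le_max_left 0 ((V T - v₀) / m)]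
    have h1 := le_max_of_deriv_nonpos_above (v₀ := V T + m * T) hW (fun s hs _ => by
      have := (hT s hs).2 (hcon s hs); linarith) ht
    rw [max_self] at h1
    have h2 : V T - v₀ ≤ m * (t - T) := by
      have : (V T - v₀) / m ≤ t - T := by rw [htdef]; simp
      calc V T - v₀ = m * ((V T - v₀) / m) := by field_simp
        _ ≤ _ := by gcongr
    have h3 := hcon t ht
    linarith
  obtain ⟨s, hs, hsv⟩ := hex
  filter_upwards [eventually_ge_atTop s] with t ht
  have := le_max_of_deriv_nonpos_above (v₀ := v₀) (fun r hr => (hT r (hs.trans hr)).1)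
    (fun r hr hv => by have := (hT r (hs.trans hr)).2 hv; linarith) ht
  rwa [max_eq_right hsv] at this

/-- A function continuous on `[0, ∞)` and eventually bounded is bounded on `[0, ∞)`. -/
theorem exists_bound_of_eventually_bound {F : Type*} [SeminormedAddCommGroup F] {u : ℝ → F}
    (hu : ContinuousOn u (Ici 0)) {M : ℝ} (hM : ∀ᶠ t in atTop, ‖u t‖ ≤ M) :
    ∃ B, ∀ t, 0 ≤ t → ‖u t‖ ≤ B := by
  obtain ⟨T, hT⟩ := eventually_atTop.1 hM
  obtain ⟨C, hC⟩ := (isCompact_Icc (a := (0 : ℝ)) (b := T)).exists_bound_of_continuousOn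
    (hu.mono Icc_subset_Ici_self)
  refine ⟨max M C, fun t ht => ?_⟩
  rcases le_total T t with h | h
  · exact (hT t h).trans (le_max_left _ _)
  · exact (hC t ⟨ht, h⟩).trans (le_max_right _ _)

end Comparison

/-! ### Abstract consensus dynamics and dynamic averaging. -/

section Consensus

variable {H : Type*} [NormedAddCommGroup H] [InnerProductSpace ℝ H]

/-- `L` is a symmetric operator vanishing on the range of the orthogonal projection `P` and
positive definite on its kernel. -/
structure IsLaplacian (L P : H →L[ℝ] H) : Prop where
  symm : ∀ x y, inner ℝ (L x) y = inner ℝ x (L y)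
  proj_symm : ∀ x y, inner ℝ (P x) y = inner ℝ x (P y)
  proj_idem : ∀ x, P (P x) = P x
  apply_proj : ∀ x, L (P x) = 0
  coercive : ∃ l > 0, ∀ x, P x = 0 → l * ‖x‖ ^ 2 ≤ inner ℝ x (L x)

namespace IsLaplacian

variable {L P : H →L[ℝ] H}

theorem proj_apply (h : IsLaplacian L P) (x : H) : P (L x) = 0 := by
  refine ext_inner_right ℝ fun y => ?_
  rw [h.proj_symm, h.symm, h.apply_proj, inner_zero_right, inner_zero_left]

theorem proj_sub_proj (h : IsLaplacian L P) (x : H) : P (x - P x) = 0 := by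
  rw [map_sub, h.proj_idem, sub_self]

/-- Disagreement of agents driven by a bounded input. -/
theorem eventually_disagreement_le (h : IsLaplacian L P) :
    ∃ K > 0, ∀ (s v : ℝ → H) (S : ℝ), 0 < S →
      (∀ᶠ t in atTop, HasDerivAt s (v t - L (s t)) t) → (∀ᶠ t in atTop, ‖v t‖ ≤ S) →
      ∀ᶠ t in atTop, ‖s t - P (s t)‖ ≤ K * S := by
  obtain ⟨l, hl, hcoer⟩ := h.coercive
  -- Young's inequality makes `‖z‖² - S²/l²` decay at rate `l`, so eventually `‖z‖² ≤ 2 S²/l²`; the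
  -- factor 2 leaves room.
  refine ⟨2 / l, by positivity, fun s v S hS hd hv => ?_⟩
  set z : ℝ → H := fun t => s t - P (s t) with hz
  have hPz : ∀ t, P (z t) = 0 := fun t => h.proj_sub_proj _
  have hX : ∀ᶠ t in atTop, HasDerivAt (fun t => ‖z t‖ ^ 2 - S ^ 2 / l ^ 2)
      (2 * inner ℝ (z t) (v t - P (v t) - L (z t))) t := by
    filter_upwards [hd] with t ht
    have h1 : HasDerivAt z (v t - P (v t) - L (z t)) t := by
      refine (ht.sub (P.hasFDerivAt.comp_hasDerivAt t ht)).congr_deriv ?_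
      simp only [hz, map_sub, h.proj_apply, h.apply_proj]
      abel
    exact h1.norm_sq.sub_const _
  have hle : ∀ᶠ t in atTop, 2 * inner ℝ (z t) (v t - P (v t) - L (z t)) ≤
      -l * (‖z t‖ ^ 2 - S ^ 2 / l ^ 2) := by
    filter_upwards [hv] with t ht
    have h1 : inner ℝ (z t) (v t - P (v t) - L (z t)) =
        inner ℝ (z t) (v t) - inner ℝ (z t) (L (z t)) := by
      rw [inner_sub_right, inner_sub_right, ← h.proj_symm, hPz]; simp
    have h2 : inner ℝ (z t) (v t) ≤ ‖z t‖ * S :=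
      (real_inner_le_norm _ _).trans (by gcongr)
    have h3 := hcoer (z t) (hPz t)
    have h4 : 2 * (‖z t‖ * S) ≤ l * ‖z t‖ ^ 2 + S ^ 2 / l := by
      have : 0 ≤ (l * ‖z t‖ - S) ^ 2 / l := by positivity
      have h5 : (l * ‖z t‖ - S) ^ 2 / l = l * ‖z t‖ ^ 2 - 2 * (‖z t‖ * S) + S ^ 2 / l := by
        field_simp; ring
      linarith
    have h6 : -l * (‖z t‖ ^ 2 - S ^ 2 / l ^ 2) = -(l * ‖z t‖ ^ 2) + S ^ 2 / l := by
      field_simp; ring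
    rw [h1, h6]
    linarith
  filter_upwards [eventually_le_of_deriv_le_neg_mul hl hX hle
    (show 0 < S ^ 2 / l ^ 2 by positivity)] with t ht
  refine abs_le_of_sq_le_sq' ?_ (by positivity) |>.2
  have : (2 / l * S) ^ 2 = 4 * (S ^ 2 / l ^ 2) := by field_simp; ring
  have h0 : 0 < S ^ 2 / l ^ 2 := by positivity
  rw [this]
  linarith

/-- The inverse of a Laplacian on the complement of its kernel. -/
theorem exists_pseudoinverse [FiniteDimensional ℝ H] (h : IsLaplacian L P) :
    ∃ G : H →L[ℝ] H, (∀ x, L (G x) = x - P x) ∧ ∀ x, P (G x) = 0 := by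
  obtain ⟨l, hl, hcoer⟩ := h.coercive
  -- `L + P` is invertible, since `P` fills in the kernel of `L`; its inverse, with the consensus
  -- part removed, is the operator sought.
  have hinj : Function.Injective ((L + P : H →L[ℝ] H) : H →ₗ[ℝ] H) := by
    rw [← LinearMap.ker_eq_bot, LinearMap.ker_eq_bot']
    intro x hx
    have hx' : L x + P x = 0 := hx
    have hP : P x = 0 := by
      have := congrArg P hx'
      simpa [h.proj_apply, h.proj_idem] using this
    have hL : L x = 0 := by simpa [hP] using hx'
    have := hcoer x hP
    rw [hL, inner_zero_right] at this
    have h2 : ‖x‖ ^ 2 ≤ 0 := by nlinarith [sq_nonneg ‖x‖]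
    simpa using h2.antisymm (sq_nonneg _)
  set e := LinearEquiv.ofInjectiveEndo _ hinj with he
  set G₀ : H →L[ℝ] H := LinearMap.toContinuousLinearMap (e.symm : H →ₗ[ℝ] H) with hG
  have hG₀ : ∀ x, L (G₀ x) + P (G₀ x) = x := fun x => e.apply_symm_apply x
  have hPG : ∀ x, P (G₀ x) = P x := by
    intro x
    have := congrArg P (hG₀ x)
    simpa [h.proj_apply, h.proj_idem] using this
  refine ⟨G₀ - P.comp G₀, fun x => ?_, fun x => ?_⟩
  · have := hG₀ x
    rw [hPG] at this
    simp only [sub_apply, ContinuousLinearMap.comp_apply, map_sub,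
      h.apply_proj, sub_zero]
    exact eq_sub_of_add_eq this
  · simp [h.proj_idem]

/-- The scalar core of `exists_lyapunov`: `a`, `b`, `c` stand for `‖x‖`, `‖y‖`, `‖w‖`, and `Λ`
bounds the operator norms. By Young's inequality the mixed terms use up half of the damping `-2a²`
and half of `-2νl²b²`; the small `ν` lets the former also absorb what the cross term adds in `a`. -/
theorem lyapunov_estimate {a b c l Λ ν : ℝ} (ha : 0 ≤ a) (hb : 0 ≤ b) (hc : 0 ≤ c) (hl : 0 < l)
    (hl1 : l ≤ 1) (hΛ1 : 1 ≤ Λ) (hν : ν = l ^ 2 / (8 * Λ ^ 2)) :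
    -2 * a ^ 2 + 2 * (a * (Λ * c)) + 2 * (b * (Λ * c)) +
      2 * ν * (Λ ^ 2 * a ^ 2 + Λ * a * (Λ * c) + a * (Λ * b) - l ^ 2 * b ^ 2 + Λ * c * (Λ * b)) ≤
    -(ν * l ^ 2 / 2 * (2 * (a ^ 2 + b ^ 2))) +
      8 * Λ ^ 2 * (1 + 1 / (ν * l ^ 2)) * c ^ 2 := by
  have hν0 : 0 < ν := by rw [hν]; positivity
  have hνΛ : ν * Λ ^ 2 = l ^ 2 / 8 := by rw [hν]; field_simp
  have hl2 : l ^ 2 ≤ 1 := pow_le_one₀ hl.le hl1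
  have hνΛ1 : ν * Λ ≤ 1 / 8 := by nlinarith
  have hν1 : ν ≤ 1 / 8 := by nlinarith
  have y1 : 2 * ν * (Λ * (a * b)) ≤ ν * l ^ 2 * b ^ 2 / 2 + a ^ 2 / 4 := by
    have h3 : ν * (2 * (Λ * (a * b))) ≤
        ν * (l ^ 2 * b ^ 2 / 2 + 2 * Λ ^ 2 * a ^ 2 / l ^ 2) := by
      gcongr
      have h4 : 0 ≤ (l * b - 2 * Λ * a / l) ^ 2 := sq_nonneg _
      have h5 : (l * b - 2 * Λ * a / l) ^ 2 =
        l ^ 2 * b ^ 2 - 4 * (Λ * (a * b)) + 4 * Λ ^ 2 * a ^ 2 / l ^ 2 := by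
        field_simp; ring
      have h6 : 2 * Λ ^ 2 * a ^ 2 / l ^ 2 = (4 * Λ ^ 2 * a ^ 2 / l ^ 2) / 2 := by ring
      linarith
    have h4 : ν * (2 * Λ ^ 2 * a ^ 2 / l ^ 2) = a ^ 2 / 4 := by
      rw [hν]; field_simp; ring
    linarith
  have y2 : 2 * ν * (Λ ^ 2 * a ^ 2) ≤ a ^ 2 / 4 := by
    have : 2 * ν * (Λ ^ 2 * a ^ 2) = l ^ 2 / 4 * a ^ 2 := by
      rw [show 2 * ν * (Λ ^ 2 * a ^ 2) = 2 * (ν * Λ ^ 2) * a ^ 2 by ring, hνΛ]; ring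
    rw [this]
    nlinarith [sq_nonneg a]
  have y3 : 4 * (Λ * (a * c)) ≤ a ^ 2 / 2 + 8 * Λ ^ 2 * c ^ 2 := by
    nlinarith [sq_nonneg (a - 4 * Λ * c)]
  have y4 : 4 * (Λ * (b * c)) ≤
      ν * l ^ 2 * b ^ 2 / 2 + 8 * Λ ^ 2 * (1 / (ν * l ^ 2)) * c ^ 2 := by
    have hk : 0 < ν * l ^ 2 := by positivity
    have h1 : 0 ≤ (ν * l ^ 2 * b - 4 * Λ * c) ^ 2 / (2 * (ν * l ^ 2)) := by positivity
    have h2 : (ν * l ^ 2 * b - 4 * Λ * c) ^ 2 / (2 * (ν * l ^ 2)) =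
        ν * l ^ 2 * b ^ 2 / 2 + 8 * Λ ^ 2 * (1 / (ν * l ^ 2)) * c ^ 2
          - 4 * (Λ * (b * c)) := by
      field_simp; ring
    linarith
  have y5 : 2 * ν * (Λ * c * (Λ * b)) ≤ 2 * (Λ * (b * c)) := by
    have : ν * Λ * (2 * (Λ * (b * c))) ≤ 1 * (2 * (Λ * (b * c))) := by
      gcongr; linarith
    linarith
  have y6 : 2 * ν * (Λ * a * (Λ * c)) ≤ 2 * (Λ * (a * c)) := by
    have : ν * Λ * (2 * (Λ * (a * c))) ≤ 1 * (2 * (Λ * (a * c))) := by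
      gcongr; linarith
    linarith
  have z3 : ν * l ^ 2 * a ^ 2 ≤ 1 / 8 * a ^ 2 := by
    gcongr
    nlinarith
  have z4 := sq_nonneg a
  have z5 : 8 * Λ ^ 2 * (1 + 1 / (ν * l ^ 2)) * c ^ 2 =
      8 * Λ ^ 2 * c ^ 2 + 8 * Λ ^ 2 * (1 / (ν * l ^ 2)) * c ^ 2 := by ring
  linarith

/-- Quadratic Lyapunov function of the averaging algorithm. -/
theorem exists_lyapunov (h : IsLaplacian L P) (G : H →L[ℝ] H) :
    ∃ ν lam C : ℝ, 0 < lam ∧ 0 < C ∧ ∀ x y w : H, P y = 0 →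
      (‖x‖ ^ 2 + ‖y‖ ^ 2) / 2 ≤ ‖x‖ ^ 2 + ‖y‖ ^ 2 + 2 * ν * inner ℝ x (L y) ∧
      2 * inner ℝ x (-x - L y - P w) + 2 * inner ℝ y (L x - G w) +
          2 * ν * (inner ℝ x (L (L x - G w)) + inner ℝ (-x - L y - P w) (L y)) ≤
        -lam * (‖x‖ ^ 2 + ‖y‖ ^ 2 + 2 * ν * inner ℝ x (L y)) + C * ‖w‖ ^ 2 := by
  obtain ⟨l₀, hl₀, hcoer₀⟩ := h.coercive
  obtain ⟨l, hl, hl1, hcoer⟩ : ∃ l > 0, l ≤ 1 ∧ ∀ x, P x = 0 → l * ‖x‖ ^ 2 ≤ inner ℝ x (L x) := by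
    refine ⟨min l₀ 1, by positivity, min_le_right _ _, fun x hx => (hcoer₀ x hx).trans' ?_⟩
    gcongr
    exact min_le_left _ _
  set Λ : ℝ := 1 + ‖L‖ + ‖P‖ + ‖G‖ with hΛ
  have hL0 := norm_nonneg L
  have hP0 := norm_nonneg P
  have hG0 := norm_nonneg G
  have hΛ1 : 1 ≤ Λ := by rw [hΛ]; linarith
  have hLx : ∀ x, ‖L x‖ ≤ Λ * ‖x‖ := fun x => (L.le_opNorm x).trans (by gcongr; linarith)
  have hPx : ∀ x, ‖P x‖ ≤ Λ * ‖x‖ := fun x => (P.le_opNorm x).trans (by gcongr; linarith)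
  have hGx : ∀ x, ‖G x‖ ≤ Λ * ‖x‖ := fun x => (G.le_opNorm x).trans (by gcongr; linarith)
  -- In `‖x‖² + ‖y‖²` the coupling through `L` is skew and leaves `y` undamped. The cross term
  -- `2ν⟨x, L y⟩` contributes `-2ν‖L y‖²`, which is coercive because `P y = 0`.
  set ν : ℝ := l ^ 2 / (8 * Λ ^ 2) with hν
  have hν0 : 0 < ν := by positivity
  have hνΛ : ν * Λ ^ 2 = l ^ 2 / 8 := by rw [hν]; field_simp
  have hl2 : l ^ 2 ≤ 1 := pow_le_one₀ hl.le hl1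
  have hνΛ1 : ν * Λ ≤ 1 / 8 := by nlinarith
  refine ⟨ν, ν * l ^ 2 / 2, 8 * Λ ^ 2 * (1 + 1 / (ν * l ^ 2)), by positivity, by positivity,
    fun x y w hy => ?_⟩
  have ha := norm_nonneg x
  have hb := norm_nonneg y
  have hc := norm_nonneg w
  have hly : l * ‖y‖ ≤ ‖L y‖ := by
    rcases hb.eq_or_lt with h0 | h0
    · rw [← h0]; simp
    · have h1 := (hcoer y hy).trans (real_inner_le_norm _ _)
      exact le_of_mul_le_mul_left (by linarith [sq ‖y‖]) h0
  have hly2 : l ^ 2 * ‖y‖ ^ 2 ≤ ‖L y‖ ^ 2 := by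
    rw [← mul_pow]; exact pow_le_pow_left₀ (by positivity) hly 2
  have habs : ∀ {u v : H} {A B : ℝ}, ‖u‖ ≤ A → ‖v‖ ≤ B → |inner ℝ u v| ≤ A * B := by
    intro u v A B hu hv
    exact (abs_real_inner_le_norm u v).trans
      (mul_le_mul hu hv (norm_nonneg _) ((norm_nonneg _).trans hu))
  have e1 := abs_le.1 (habs (le_refl ‖x‖) (hLx y))
  have e2 := abs_le.1 (habs (le_refl ‖x‖) (hPx w))
  have e3 := abs_le.1 (habs (le_refl ‖y‖) (hGx w))
  have e4 := abs_le.1 (habs (hPx w) (hLx y))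
  have e5 := abs_le.1 (habs (hLx x) (hGx w))
  have e6 : ‖L x‖ ^ 2 ≤ Λ ^ 2 * ‖x‖ ^ 2 := by
    rw [← mul_pow]; exact pow_le_pow_left₀ (norm_nonneg _) (hLx x) 2
  have hab : ν * (‖x‖ * (Λ * ‖y‖)) ≤ (‖x‖ ^ 2 + ‖y‖ ^ 2) / 16 := by
    have : ν * Λ * (‖x‖ * ‖y‖) ≤ 1 / 8 * (‖x‖ * ‖y‖) := by gcongr
    linarith [two_mul_le_add_sq ‖x‖ ‖y‖]
  have hW1 : |ν * inner ℝ x (L y)| ≤ (‖x‖ ^ 2 + ‖y‖ ^ 2) / 16 := by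
    rw [abs_mul, abs_of_pos hν0]
    exact (mul_le_mul_of_nonneg_left (abs_le.2 e1) hν0.le).trans hab
  have hW := abs_le.1 hW1
  have hsq := add_nonneg (sq_nonneg ‖x‖) (sq_nonneg ‖y‖)
  refine ⟨by linarith [hW.1], ?_⟩
  have hexp : 2 * inner ℝ x (-x - L y - P w) + 2 * inner ℝ y (L x - G w) +
      2 * ν * (inner ℝ x (L (L x - G w)) + inner ℝ (-x - L y - P w) (L y)) =
      -2 * ‖x‖ ^ 2 - 2 * inner ℝ x (P w) - 2 * inner ℝ y (G w) +
      2 * ν * (‖L x‖ ^ 2 - inner ℝ (L x) (G w) - inner ℝ x (L y) - ‖L y‖ ^ 2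
        - inner ℝ (P w) (L y)) := by
    have h1 : inner ℝ y (L x) = inner ℝ x (L y) := by
      rw [real_inner_comm, h.symm]
    rw [← h.symm x]
    simp only [inner_sub_right, inner_sub_left, inner_neg_right, inner_neg_left,
      real_inner_self_eq_norm_sq, h1]
    ring
  rw [hexp]
  clear hexp hPx hLx hGx habs hcoer hcoer₀
  have z1 : 2 * ν * (‖L x‖ ^ 2 - inner ℝ (L x) (G w) - inner ℝ x (L y) - ‖L y‖ ^ 2
      - inner ℝ (P w) (L y)) ≤ 2 * ν * (Λ ^ 2 * ‖x‖ ^ 2 + Λ * ‖x‖ * (Λ * ‖w‖)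
        + ‖x‖ * (Λ * ‖y‖) - l ^ 2 * ‖y‖ ^ 2 + Λ * ‖w‖ * (Λ * ‖y‖)) := by
    gcongr ?_ * ?_
    linarith [e5.1, e1.1, e4.1]
  have z2 : ν * l ^ 2 / 2 * (‖x‖ ^ 2 + ‖y‖ ^ 2 + 2 * ν * inner ℝ x (L y)) ≤
      ν * l ^ 2 / 2 * (2 * (‖x‖ ^ 2 + ‖y‖ ^ 2)) := by
    gcongr
    linarith [hW.2]
  have z3 := lyapunov_estimate ha hb hc hl hl1 hΛ1 hν
  linarith [e2.1, e3.1]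

/-- Tracking error of the averaging algorithm with input `f`, when the speed of `f` is controlled
by a slowly varying quantity `Y`. -/
theorem eventually_tracking_le [FiniteDimensional ℝ H] (h : IsLaplacian L P) :
    ∃ G : H →L[ℝ] H, ∃ lam > 0, ∃ K > 0, ∀ (δ q f f' : ℝ → H) (Y Y' : ℝ → ℝ) (α : ℝ), 0 < α →
      (∀ᶠ t in atTop, HasDerivAt δ (-(δ t - f t) - L (q t)) t) →
      (∀ᶠ t in atTop, HasDerivAt q (L (δ t)) t) →
      (∀ᶠ t in atTop, HasDerivAt f (f' t) t) →
      (∀ᶠ t in atTop, HasDerivAt Y (Y' t) t) →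
      (∀ᶠ t in atTop, ‖f' t‖ ^ 2 ≤ α * (Y t + 1)) →
      (∀ t, 0 ≤ Y t) → (∀ᶠ t in atTop, -lam * (Y t + 1) ≤ Y' t) →
      ∀ᶠ t in atTop, ‖δ t - P (f t)‖ ^ 2 ≤ K * α * (Y t + 1) ∧
        ‖q t - P (q t) - G (f t)‖ ^ 2 ≤ K * α * (Y t + 1) := by
  obtain ⟨G, hLG, hPG⟩ := h.exists_pseudoinverse
  obtain ⟨ν, lam, C, hlam, hC, hlyap⟩ := h.exists_lyapunov G
  refine ⟨G, lam / 2, by positivity, 8 * C / lam, by positivity, ?_⟩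
  intro δ q f f' Y Y' α hα hδ hq hf hY hf' hY0 hY'
  -- For constant `f` the equilibria have `δ = P f` and `q - P q = G f`; `x` and `y` are the
  -- deviations from this moving equilibrium.
  set x : ℝ → H := fun t => δ t - P (f t) with hx
  set y : ℝ → H := fun t => q t - P (q t) - G (f t) with hy
  have hPy : ∀ t, P (y t) = 0 := fun t => by
    simp only [hy, map_sub P, hPG, h.proj_idem, sub_self]
  set W : ℝ → ℝ := fun t => ‖x t‖ ^ 2 + ‖y t‖ ^ 2 + 2 * ν * inner ℝ (x t) (L (y t)) with hW
  -- With this `A`, the forcing costs `A * lam / 2 * (Y + 1)` and the possible decrease of `Y` costs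
  -- as much again, so `W - A (Y + 1)` decays at the full rate `lam`.
  set A : ℝ := 2 * C * α / lam with hA
  have hA0 : 0 < A := by positivity
  have hX : ∀ᶠ t in atTop, HasDerivAt (fun t => W t - A * (Y t + 1))
      (2 * inner ℝ (x t) (-x t - L (y t) - P (f' t)) + 2 * inner ℝ (y t) (L (x t) - G (f' t)) +
          2 * ν * (inner ℝ (x t) (L (L (x t) - G (f' t))) +
            inner ℝ (-x t - L (y t) - P (f' t)) (L (y t))) - A * Y' t) t := by
    filter_upwards [hδ, hq, hf, hY] with t hδ hq hf hY
    have hx' : HasDerivAt x (-x t - L (y t) - P (f' t)) t := by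
      refine (hδ.sub (P.hasFDerivAt.comp_hasDerivAt t hf)).congr_deriv ?_
      simp only [hx, hy, map_sub L, h.apply_proj, hLG]
      abel
    have hy' : HasDerivAt y (L (x t) - G (f' t)) t := by
      refine ((hq.sub (P.hasFDerivAt.comp_hasDerivAt t hq)).sub
        (G.hasFDerivAt.comp_hasDerivAt t hf)).congr_deriv ?_
      simp only [hx, map_sub L, h.apply_proj, h.proj_apply]
    have hLy : HasDerivAt (fun t => L (y t)) (L (L (x t) - G (f' t))) t :=
      L.hasFDerivAt.comp_hasDerivAt t hy'
    exact ((hx'.norm_sq.add hy'.norm_sq).add ((hx'.inner ℝ hLy).const_mul (2 * ν))).sub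
      ((hY.add_const 1).const_mul A)
  filter_upwards [eventually_le_of_deriv_le_neg_mul hlam hX (by
    filter_upwards [hf', hY'] with t h1 h2
    have h3 := (hlyap (x t) (y t) (f' t) (hPy t)).2
    have h4 : C * ‖f' t‖ ^ 2 ≤ C * (α * (Y t + 1)) := by gcongr
    have h5 : A * (-(lam / 2) * (Y t + 1)) ≤ A * Y' t := by gcongr
    have h6 : C * α = A * lam / 2 := by rw [hA]; field_simp
    have h7 : C * (α * (Y t + 1)) = A * lam / 2 * (Y t + 1) := by rw [← h6]; ring
    simp only [hW]
    linarith) hA0] with t ht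
  have h1 := (hlyap (x t) (y t) 0 (hPy t)).1
  have h2 : 8 * C / lam * α * (Y t + 1) = 4 * (A * (Y t + 1)) := by rw [hA]; ring
  have h3 : A ≤ A * (Y t + 1) := le_mul_of_one_le_right hA0.le (by linarith [hY0 t])
  have h4 := sq_nonneg ‖x t‖
  have h5 := sq_nonneg ‖y t‖
  rw [h2]
  constructor <;> linarith

end IsLaplacian

end Consensus

/-! ### Joint states and the weighted graph Laplacian. -/

section Network

/-- Joint states of `N` agents in `ℝⁿ`, with the Euclidean norm. -/
def State (n N : ℕ) : Type := PiLp 2 fun _ : Fin N => Vec n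

variable {n N : ℕ}

instance : NormedAddCommGroup (State n N) :=
  inferInstanceAs (NormedAddCommGroup (PiLp 2 fun _ : Fin N => Vec n))

instance : InnerProductSpace ℝ (State n N) :=
  inferInstanceAs (InnerProductSpace ℝ (PiLp 2 fun _ : Fin N => Vec n))

instance : FiniteDimensional ℝ (State n N) :=
  inferInstanceAs (FiniteDimensional ℝ (PiLp 2 fun _ : Fin N => Vec n))

namespace State

/-- A joint state as a family of states. -/
def equiv : State n N ≃L[ℝ] (Fin N → Vec n) :=
  LinearEquiv.toContinuousLinearEquiv
    (WithLp.linearEquiv 2 ℝ (Fin N → Vec n) : PiLp 2 (fun _ : Fin N => Vec n) ≃ₗ[ℝ] _)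

/-- The joint state of a family of states. -/
def mk (f : Fin N → Vec n) : State n N := equiv.symm f

/-- The state of agent `i`. -/
def coord (i : Fin N) : State n N →L[ℝ] Vec n :=
  (ContinuousLinearMap.proj i).comp equiv.toContinuousLinearMap

instance : CoeFun (State n N) fun _ => Fin N → Vec n := ⟨equiv⟩

@[simp] theorem coord_apply (s : State n N) (i : Fin N) : coord i s = s i := rfl

@[simp] theorem mk_apply (f : Fin N → Vec n) (i : Fin N) : mk f i = f i := by
  simp [mk]

theorem ext {s t : State n N} (h : ∀ i, s i = t i) : s = t :=
  equiv.injective (funext h)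

theorem inner_eq_sum (s t : State n N) : inner ℝ s t = ∑ i, inner ℝ (s i) (t i) := rfl

theorem norm_sq_eq_sum (s : State n N) : ‖s‖ ^ 2 = ∑ i, ‖s i‖ ^ 2 := by
  simp only [← real_inner_self_eq_norm_sq, inner_eq_sum]

theorem norm_coord_le (s : State n N) (i : Fin N) : ‖s i‖ ≤ ‖s‖ := by
  refine abs_le_of_sq_le_sq' ?_ (norm_nonneg _) |>.2
  rw [norm_sq_eq_sum]
  exact Finset.single_le_sum (f := fun i => ‖s i‖ ^ 2) (fun i _ => sq_nonneg _) (Finset.mem_univ i)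

theorem norm_le {s : State n N} {C : ℝ} (hC : ∀ i, ‖s i‖ ≤ C) : ‖s‖ ≤ N * C := by
  rcases isEmpty_or_nonempty (Fin N) with h | ⟨⟨i₀⟩⟩
  · have hN : N = 0 := by_contra fun h0 => h.elim ⟨0, Nat.pos_of_ne_zero h0⟩
    subst hN
    simp [show s = 0 from ext fun i => i.elim0]
  have hC0 : 0 ≤ C := (norm_nonneg _).trans (hC i₀)
  have hN : (1 : ℝ) ≤ N := by exact_mod_cast Nat.succ_le_of_lt i₀.pos
  refine abs_le_of_sq_le_sq' ?_ (by positivity) |>.2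
  rw [norm_sq_eq_sum]
  calc ∑ i, ‖s i‖ ^ 2 ≤ ∑ _i : Fin N, C ^ 2 := by
        gcongr with i
        exact hC i
    _ = N * C ^ 2 := by simp
    _ ≤ N * (N * C ^ 2) := le_mul_of_one_le_left (by positivity) hN
    _ = (N * C) ^ 2 := by ring

theorem hasDerivWithinAt_iff {f : ℝ → State n N} {f' : State n N} {s : Set ℝ} {t : ℝ} :
    HasDerivWithinAt f f' s t ↔ ∀ i, HasDerivWithinAt (fun r => f r i) (f' i) s t := by
  refine ⟨fun h i => (coord i).hasFDerivAt.comp_hasDerivWithinAt t h, fun h => ?_⟩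
  have h1 : HasDerivWithinAt (fun r => equiv (f r)) (equiv f') s t := hasDerivWithinAt_pi.2 h
  have h2 := equiv.symm.hasFDerivAt.comp_hasDerivWithinAt t h1
  simpa [Function.comp_def] using h2

theorem hasDerivAt_iff {f : ℝ → State n N} {f' : State n N} {t : ℝ} :
    HasDerivAt f f' t ↔ ∀ i, HasDerivAt (fun r => f r i) (f' i) t := by
  simp only [← hasDerivWithinAt_univ]
  exact hasDerivWithinAt_iff

end State

/-- The weighted graph Laplacian acting on joint states. -/
def laplacian (w : Fin N → Fin N → ℝ) : State n N →L[ℝ] State n N :=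
  (State.equiv.symm.toContinuousLinearMap).comp
    (ContinuousLinearMap.pi fun i => ∑ j, w i j • (State.coord i - State.coord j))

theorem laplacian_apply (w : Fin N → Fin N → ℝ) (s : State n N) (i : Fin N) :
    laplacian w s i = ∑ j, w i j • (s i - s j) := by
  simp [laplacian]

/-- The average of a joint state. -/
def mean : State n N →L[ℝ] Vec n := (N : ℝ)⁻¹ • ∑ i, State.coord i

theorem mean_apply (s : State n N) : mean s = (N : ℝ)⁻¹ • ∑ i, s i := by
  simp [mean]

/-- The orthogonal projection onto the joint states on which all agents agree. -/
def consensus : State n N →L[ℝ] State n N :=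
  (State.equiv.symm.toContinuousLinearMap).comp (ContinuousLinearMap.pi fun _ => mean)

theorem consensus_apply (s : State n N) (i : Fin N) : consensus s i = mean s := by
  simp [consensus]

theorem mean_mk_const (hN : 0 < N) (v : Vec n) : mean (State.mk fun _ : Fin N => v) = v := by
  have hN' : (N : ℝ) ≠ 0 := by positivity
  rw [mean_apply]
  simp only [State.mk_apply, Finset.sum_const, Finset.card_univ, Fintype.card_fin]
  rw [← Nat.cast_smul_eq_nsmul ℝ, smul_smul, inv_mul_cancel₀ hN', one_smul]

/-- Average the double sum with its copy under exchange of `i` and `j`. This form shows the symmetry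
of the Laplacian and, for `x = y`, its nonnegativity. -/
theorem two_mul_inner_laplacian {w : Fin N → Fin N → ℝ} (hw : ∀ i j, w i j = w j i)
    (x y : State n N) :
    2 * inner ℝ (laplacian w x) y = ∑ i, ∑ j, w i j * inner ℝ (x i - x j) (y i - y j) := by
  have h1 : inner ℝ (laplacian w x) y = ∑ i, ∑ j, w i j * inner ℝ (x i - x j) (y i) := by
    simp only [State.inner_eq_sum, laplacian_apply, sum_inner, real_inner_smul_left]
  have h2 : inner ℝ (laplacian w x) y = ∑ i, ∑ j, w i j * inner ℝ (x j - x i) (y j) := by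
    rw [h1, Finset.sum_comm]
    exact Finset.sum_congr rfl fun i _ => Finset.sum_congr rfl fun j _ => by rw [hw]
  rw [two_mul]
  nth_rw 1 [h1]
  rw [h2, ← Finset.sum_add_distrib]
  refine Finset.sum_congr rfl fun i _ => ?_
  rw [← Finset.sum_add_distrib]
  refine Finset.sum_congr rfl fun j _ => ?_
  rw [← neg_sub (x i) (x j), inner_neg_left, inner_sub_right]
  ring

/-- If the energy vanishes, neighbours agree, hence by connectedness all agents agree, and zero mean
forces the state to be zero. Compactness of the unit sphere upgrades positivity to coercivity. -/
theorem isLaplacian_laplacian (hN : 0 < N) {w : Fin N → Fin N → ℝ} (hw : IsConnectedWeight w) :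
    IsLaplacian (laplacian w) (consensus : State n N →L[ℝ] State n N) := by
  have hN' : (N : ℝ) ≠ 0 := by positivity
  have hsymm : ∀ x y : State n N, inner ℝ (laplacian w x) y = inner ℝ x (laplacian w y) := by
    intro x y
    have h1 := two_mul_inner_laplacian hw.symm x y
    have h2 := two_mul_inner_laplacian hw.symm y x
    rw [real_inner_comm (laplacian w y) x]
    have h3 : ∑ i, ∑ j, w i j * inner ℝ (x i - x j) (y i - y j) =
        ∑ i, ∑ j, w i j * inner ℝ (y i - y j) (x i - x j) := by
      simp only [real_inner_comm]
    linarith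
  have hpos : ∀ x : State n N, consensus x = 0 → x ≠ 0 → 0 < inner ℝ x (laplacian w x) := by
    intro x hx hx0
    have hterm : ∀ i j, 0 ≤ w i j * ‖x i - x j‖ ^ 2 := fun i j =>
      mul_nonneg (hw.nonneg i j) (sq_nonneg _)
    have h2 : 2 * inner ℝ x (laplacian w x) = ∑ i, ∑ j, w i j * ‖x i - x j‖ ^ 2 := by
      rw [← hsymm, two_mul_inner_laplacian hw.symm]
      simp only [real_inner_self_eq_norm_sq]
    have h0 : 0 ≤ ∑ i, ∑ j, w i j * ‖x i - x j‖ ^ 2 :=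
      Finset.sum_nonneg fun i _ => Finset.sum_nonneg fun j _ => hterm i j
    rcases h0.lt_or_eq with h3 | h3
    · linarith
    · exfalso
      have hzero : ∀ i j, w i j * ‖x i - x j‖ ^ 2 = 0 := by
        intro i j
        have h4 := (Finset.sum_eq_zero_iff_of_nonneg
          (fun i _ => Finset.sum_nonneg fun j _ => hterm i j)).1 h3.symm i (Finset.mem_univ _)
        exact (Finset.sum_eq_zero_iff_of_nonneg (fun j _ => hterm i j)).1 h4 j (Finset.mem_univ _)
      have hedge : ∀ i j, w i j ≠ 0 → x i = x j := by
        intro i j hij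
        have := (mul_eq_zero.1 (hzero i j)).resolve_left hij
        simpa [sub_eq_zero] using this
      have hall : ∀ i j, x i = x j := by
        intro i j
        obtain ⟨p⟩ := hw.connected.preconnected i j
        induction p with
        | nil => rfl
        | cons hadj _ ih =>
          refine Eq.trans ?_ ih
          rw [SimpleGraph.fromRel_adj] at hadj
          rcases hadj.2 with h5 | h5
          · exact hedge _ _ h5
          · exact (hedge _ _ h5).symm
      refine hx0 ?_
      refine State.ext fun i => ?_
      have h5 : x = State.mk fun _ => x i := State.ext fun j => by rw [State.mk_apply, hall j i]
      rw [← mean_mk_const hN (x i), ← h5, ← consensus_apply x i, hx]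
  have hPin : ∀ x y : State n N, inner ℝ (consensus x) y = N * inner ℝ (mean x) (mean y) := by
    intro x y
    rw [mean_apply y, real_inner_smul_right, inner_sum, State.inner_eq_sum, ← mul_assoc,
      mul_inv_cancel₀ hN', one_mul]
    simp only [consensus_apply]
  refine ⟨hsymm, ?_, ?_, ?_, ?_⟩
  · intro x y
    rw [hPin, real_inner_comm, ← hPin, real_inner_comm]
  · intro x
    refine State.ext fun i => ?_
    have h1 : consensus x = State.mk fun _ => mean x := State.ext fun j => by
      rw [consensus_apply, State.mk_apply]
    rw [consensus_apply, h1, mean_mk_const hN, State.mk_apply]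
  · intro x
    exact State.ext fun i => by simp [laplacian_apply, consensus_apply]
  · have hK : IsCompact (sphere (0 : State n N) 1 ∩ {x | consensus x = 0}) :=
      (isCompact_sphere _ _).inter_right
        (isClosed_singleton.preimage (consensus : State n N →L[ℝ] State n N).continuous)
    -- This form of the minimum also covers an empty sphere, as for `N = 1`.
    obtain ⟨l, hl, hmin⟩ := hK.exists_forall_le' (f := fun x => inner ℝ x (laplacian w x))
      (by fun_prop) (a := 0) (fun x hx => hpos x hx.2 (by
        rintro rfl
        simpa using hx.1))
    refine ⟨l, hl, fun x hx => ?_⟩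
    rcases eq_or_ne x 0 with rfl | hx0
    · simp
    have hn : ‖x‖ ≠ 0 := norm_ne_zero_iff.2 hx0
    have h1 := hmin (‖x‖⁻¹ • x) ⟨by simp [norm_smul, hn], by simp [hx]⟩
    simp only [map_smul, inner_smul_left, inner_smul_right] at h1
    have h2 : inner ℝ x (laplacian w x) =
        ‖x‖ ^ 2 * (‖x‖⁻¹ * (‖x‖⁻¹ * inner ℝ x (laplacian w x))) := by field_simp
    rw [h2, mul_comm l]
    gcongr
    simpa using h1

theorem IsLaplacian.const_smul {H : Type*} [NormedAddCommGroup H] [InnerProductSpace ℝ H]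
    {L P : H →L[ℝ] H} (h : IsLaplacian L P) {c : ℝ} (hc : 0 < c) : IsLaplacian (c • L) P := by
  refine ⟨fun x y => ?_, h.proj_symm, h.proj_idem, fun x => ?_, ?_⟩
  · simp [inner_smul_left, inner_smul_right, h.symm]
  · simp [h.apply_proj]
  · obtain ⟨l, hl, hcoer⟩ := h.coercive
    refine ⟨c * l, by positivity, fun x hx => ?_⟩
    simp only [smul_apply, inner_smul_right, mul_assoc]
    exact mul_le_mul_of_nonneg_left (hcoer x hx) hc.le

end Network

/-! ### The formation: a scaled centered tight frame. -/

section Formation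

/-- A centered configuration of `N ≥ n + 1` points with identity second-moment matrix. -/
theorem exists_centered_frame {n N : ℕ} (hN : n + 1 ≤ N) :
    ∃ e : Fin N → Vec n, ∑ i, e i = 0 ∧
      ∀ k l, ∑ i, e i k * e i l = (1 : Matrix (Fin n) (Fin n) ℝ) k l := by
  set v : EuclideanSpace ℝ (Fin N) := WithLp.toLp 2 fun _ => 1 with hv
  have hv0 : v ≠ 0 := by
    intro h
    have := congrArg (fun x : EuclideanSpace ℝ (Fin N) => x ⟨0, by omega⟩) h
    simp [hv] at this
  -- The complement of the all-ones vector has dimension `N - 1 ≥ n`. The `k`-th coordinates of the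
  -- points form the `k`-th of `n` orthonormal vectors in it: orthogonality to `v` is centering,
  -- orthonormality is the moment condition.
  set W := (Submodule.span ℝ {v})ᗮ with hW
  have hfin : n ≤ Module.finrank ℝ W := by
    have : Fact (Module.finrank ℝ (EuclideanSpace ℝ (Fin N)) = (N - 1) + 1) :=
      ⟨by rw [finrank_euclideanSpace_fin]; omega⟩
    rw [hW, Submodule.finrank_orthogonal_span_singleton (n := N - 1) hv0]
    omega
  set b := stdOrthonormalBasis ℝ W with hb
  refine ⟨fun i => WithLp.toLp 2 fun k => (b (Fin.castLE hfin k) : EuclideanSpace ℝ (Fin N)) i,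
    ?_, fun k l => ?_⟩
  · ext k
    have h1 : inner ℝ v (b (Fin.castLE hfin k) : EuclideanSpace ℝ (Fin N)) = 0 :=
      Submodule.mem_orthogonal_singleton_iff_inner_right.1 (b (Fin.castLE hfin k)).2
    simpa [hv, PiLp.inner_apply] using h1
  · have h1 := orthonormal_iff_ite.1 b.orthonormal (Fin.castLE hfin l) (Fin.castLE hfin k)
    rw [Submodule.coe_inner, PiLp.inner_apply] at h1
    simp only [RCLike.inner_apply, conj_trivial] at h1
    rw [h1, Matrix.one_apply]
    simp [eq_comm]

/-- The frame identity through which weighted samples of `h` reproduce its gradient. -/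
theorem sum_inner_smul_frame {n N : ℕ} {e : Fin N → Vec n}
    (he : ∀ k l, ∑ i, e i k * e i l = (1 : Matrix (Fin n) (Fin n) ℝ) k l) (g : Vec n) :
    ∑ i, (inner ℝ g (e i) : ℝ) • e i = g := by
  ext l
  simp only [PiLp.inner_apply, RCLike.inner_apply, conj_trivial, WithLp.ofLp_sum, WithLp.ofLp_smul,
    Finset.sum_apply, Pi.smul_apply, smul_eq_mul, Finset.sum_mul]
  rw [Finset.sum_comm]
  have : ∀ k, ∑ i, e i k * g k * e i l = g k * (1 : Matrix (Fin n) (Fin n) ℝ) k l := by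
    intro k
    rw [← he, Finset.mul_sum]
    exact Finset.sum_congr rfl fun i _ => by ring
  simp [this, Matrix.one_apply]

variable {n N : ℕ} {e : Fin N → Vec n} {ε : ℝ}

theorem relCenter_scaled (hN : 0 < N) (he0 : ∑ i, e i = 0) (i : Fin N) :
    relCenter (fun i j => ε • (e i - e j)) i = ε • e i := by
  have hN' : (N : ℝ) ≠ 0 := by positivity
  rw [relCenter, ← Finset.smul_sum, Finset.sum_sub_distrib, he0, sub_zero]
  simp only [Finset.sum_const, Finset.card_univ, Fintype.card_fin]
  rw [← Nat.cast_smul_eq_nsmul ℝ, smul_comm ε, smul_smul, inv_mul_cancel₀ hN', one_smul]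

theorem formationMatrix_scaled (hN : 0 < N) (he0 : ∑ i, e i = 0)
    (he : ∀ k l, ∑ i, e i k * e i l = (1 : Matrix (Fin n) (Fin n) ℝ) k l) :
    formationMatrix (fun i j => ε • (e i - e j)) = ε ^ 2 • (1 : Matrix (Fin n) (Fin n) ℝ) := by
  ext k l
  simp only [formationMatrix, relCenter_scaled hN he0, Matrix.sum_apply, Matrix.vecMulVec_apply,
    Matrix.smul_apply, ← he, smul_eq_mul, Finset.mul_sum, PiLp.smul_apply]
  exact Finset.sum_congr rfl fun i _ => by ring

theorem isFormation_scaled (hN : 0 < N) (he0 : ∑ i, e i = 0)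
    (he : ∀ k l, ∑ i, e i k * e i l = (1 : Matrix (Fin n) (Fin n) ℝ) k l) (hε : 0 < ε) :
    IsFormation (fun i j => ε • (e i - e j)) := by
  refine ⟨fun i j => ?_, fun i j k => ?_, ?_⟩
  · rw [← smul_neg, neg_sub]
  · rw [← smul_add, sub_add_sub_cancel]
  · rw [formationMatrix_scaled hN he0 he, Matrix.det_smul, Matrix.det_one]
    positivity

theorem toLp_inv_formationMatrix_mulVec (hN : 0 < N) (he0 : ∑ i, e i = 0)
    (he : ∀ k l, ∑ i, e i k * e i l = (1 : Matrix (Fin n) (Fin n) ℝ) k l) (hε : 0 < ε)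
    (x : Vec n) :
    WithLp.toLp 2 (Matrix.mulVec (formationMatrix (fun i j => ε • (e i - e j)))⁻¹ x.ofLp) =
      (ε ^ 2)⁻¹ • x := by
  have h : (formationMatrix (fun i j => ε • (e i - e j)))⁻¹ =
      (ε ^ 2)⁻¹ • (1 : Matrix (Fin n) (Fin n) ℝ) := by
    rw [formationMatrix_scaled hN he0 he]
    refine Matrix.inv_eq_right_inv ?_
    rw [Matrix.smul_mul, Matrix.one_mul, smul_smul, mul_inv_cancel₀ (by positivity), one_smul]
  rw [h, Matrix.smul_mulVec, Matrix.one_mulVec]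
  rfl

end Formation

/-! ### Growth of the objective and the angle condition of the saturation. -/

section Objective

variable {n : ℕ} {h : Vec n → ℝ} {ω ϑ : ℝ}

namespace IsObjective

theorem gradient_zero (hh : IsObjective h ω ϑ) : gradient h 0 = 0 := by
  have hmin : IsLocalMin h 0 := Eventually.of_forall hh.minimizer
  rw [gradient, hmin.fderiv_eq_zero, map_zero]

theorem norm_gradient_le (hh : IsObjective h ω ϑ) (x : Vec n) : ‖gradient h x‖ ≤ ϑ * ‖x‖ := by
  simpa [hh.gradient_zero] using hh.lipschitz_gradient x 0

theorem le_norm_gradient (hh : IsObjective h ω ϑ) (x : Vec n) : ω * ‖x‖ ≤ ‖gradient h x‖ := by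
  have h1 := hh.strong_convexity x 0
  simp only [sub_zero, hh.gradient_zero] at h1
  rcases (norm_nonneg x).eq_or_lt with h0 | h0
  · rw [← h0]; simp
  · have h2 := h1.trans (real_inner_le_norm _ _)
    exact le_of_mul_le_mul_left (by linarith [sq ‖x‖]) h0

theorem hasDerivAt_comp (hh : IsObjective h ω ϑ) {x : ℝ → Vec n} {x' : Vec n} {t : ℝ}
    (hx : HasDerivAt x x' t) :
    HasDerivAt (fun s => h (x s)) (inner ℝ (gradient h (x t)) x') t := by
  exact ((hh.differentiable (x t)).hasGradientAt.hasFDerivAt.comp_hasDerivAt t hx).congr_deriv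
    (InnerProductSpace.toDual_apply_apply ..)

theorem exists_mean_value (hh : IsObjective h ω ϑ) (x w : Vec n) :
    ∃ s ∈ Ioo (0 : ℝ) 1, h (x + w) - h x = inner ℝ (gradient h (x + s • w)) w := by
  have hd : ∀ s : ℝ, HasDerivAt (fun s : ℝ => h (x + s • w))
      (inner ℝ (gradient h (x + s • w)) w) s := by
    intro s
    refine hh.hasDerivAt_comp ?_
    simpa using ((hasDerivAt_id s).smul_const w).const_add x
  obtain ⟨s, hs, hs'⟩ := exists_hasDerivAt_eq_slope (fun s : ℝ => h (x + s • w)) _ zero_lt_one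
    (fun s _ => (hd s).continuousAt.continuousWithinAt) (fun s _ => hd s)
  exact ⟨s, hs, by simpa using hs'.symm⟩

/-- Mean value theorem and Lipschitz gradient; without integration the constant is `ϑ` rather than
`ϑ / 2`. -/
theorem abs_taylor_le (hh : IsObjective h ω ϑ) (x w : Vec n) :
    |h (x + w) - h x - inner ℝ (gradient h x) w| ≤ ϑ * ‖w‖ ^ 2 := by
  obtain ⟨s, hs, hs'⟩ := hh.exists_mean_value x w
  rw [hs', ← inner_sub_left]
  have h1 := hh.lipschitz_gradient (x + s • w) x
  rw [add_sub_cancel_left, norm_smul, Real.norm_of_nonneg hs.1.le] at h1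
  have h2 : ϑ * (s * ‖w‖) ≤ ϑ * (1 * ‖w‖) := by
    gcongr
    · exact hh.theta_pos.le
    · exact hs.2.le
  calc _ ≤ ‖gradient h (x + s • w) - gradient h x‖ * ‖w‖ := abs_real_inner_le_norm _ _
    _ ≤ ϑ * (1 * ‖w‖) * ‖w‖ := by gcongr; exact h1.trans h2
    _ = _ := by ring

theorem sub_le (hh : IsObjective h ω ϑ) (x : Vec n) : h x - h 0 ≤ ϑ * ‖x‖ ^ 2 := by
  have := (abs_le.1 (hh.abs_taylor_le 0 x)).2
  simpa [hh.gradient_zero] using this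

/-- On the segment from `x / 2` to `x` the derivative of `h` in direction `x` is at least `ω / 2 *
‖x‖²`, and `h (x / 2) ≥ h 0`. -/
theorem le_sub (hh : IsObjective h ω ϑ) (x : Vec n) : ω / 4 * ‖x‖ ^ 2 ≤ h x - h 0 := by
  obtain ⟨s, hs, hs'⟩ := hh.exists_mean_value ((1 / 2 : ℝ) • x) ((1 / 2 : ℝ) • x)
  have hr : 1 / 2 < 1 / 2 + s * (1 / 2) := by linarith [hs.1]
  set r : ℝ := 1 / 2 + s * (1 / 2) with hrdef
  have e1 : (1 / 2 : ℝ) • x + (1 / 2 : ℝ) • x = x := by rw [← add_smul]; norm_num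
  have e2 : (1 / 2 : ℝ) • x + s • (1 / 2 : ℝ) • x = r • x := by rw [smul_smul, ← add_smul]
  rw [e1, e2, inner_smul_right] at hs'
  have hr0 : 0 < r := by linarith
  have h1 := hh.strong_convexity (r • x) 0
  rw [hh.gradient_zero, sub_zero, sub_zero, norm_smul, Real.norm_of_nonneg hr0.le,
    real_inner_smul_left, real_inner_comm] at h1
  have h2 : ω * r * ‖x‖ ^ 2 ≤ inner ℝ (gradient h (r • x)) x :=
    le_of_mul_le_mul_left (by linarith [mul_pow r ‖x‖ 2, sq r]) hr0
  have h3 : ω * (1 / 2) * ‖x‖ ^ 2 ≤ ω * r * ‖x‖ ^ 2 := by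
    have := hh.omega_pos
    gcongr
  have h4 := hh.minimizer ((1 / 2 : ℝ) • x)
  linarith

theorem contDiff (hh : IsObjective h ω ϑ) : ContDiff ℝ 1 h := by
  rw [contDiff_one_iff_fderiv]
  refine ⟨hh.differentiable, ?_⟩
  have h1 : Continuous (gradient h) := by
    have : LipschitzWith ϑ.toNNReal (gradient h) := LipschitzWith.of_dist_le_mul fun x y => by
      rw [dist_eq_norm, dist_eq_norm, Real.coe_toNNReal _ hh.theta_pos.le]
      exact hh.lipschitz_gradient x y
    exact this.continuous
  have h2 : fderiv ℝ h = fun x => InnerProductSpace.toDual ℝ (Vec n) (gradient h x) := by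
    funext x
    simp [gradient]
  rw [h2]
  exact (InnerProductSpace.toDual ℝ (Vec n)).continuous.comp h1

end IsObjective

/-- Away from the origin, a saturation function has a uniform angle condition. -/
theorem IsSaturation.angle_of_le_norm {σ : Vec n → Vec n} (hσ : IsSaturation σ) {ρ : ℝ}
    (hρ : 0 < ρ) :
    ∃ κ > 0, ∀ r, ρ ≤ ‖r‖ → κ * (‖r‖ * ‖σ r‖) ≤ inner ℝ r (σ r) := by
  obtain ⟨κ₀, hκ₀, R, hR⟩ := hσ.angle
  obtain ⟨S, hS⟩ := hσ.bounded
  have hc := hσ.locallyLipschitz.continuous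
  have hK : IsCompact (closedBall (0 : Vec n) R ∩ {r | ρ ≤ ‖r‖}) :=
    (isCompact_closedBall _ _).inter_right (isClosed_le continuous_const continuous_norm)
  obtain ⟨m, hm, hmin⟩ := hK.exists_forall_le' (f := fun r => inner ℝ r (σ r)) (by fun_prop)
    (a := 0) (fun r hr => hσ.inner_pos r (norm_pos_iff.1 (hρ.trans_le hr.2)))
  have hS0 : 0 ≤ S := (norm_nonneg _).trans (hS 0)
  -- For `ρ ≤ ‖r‖ ≤ R` the inner product is at least `m` by compactness, while `‖r‖ ‖σ r‖ ≤ |R| S`.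
  refine ⟨min κ₀ (m / (|R| * S + 1)), by positivity, fun r hr => ?_⟩
  rcases le_total R ‖r‖ with h | h
  · refine (hR r h).trans' ?_
    gcongr
    exact min_le_left _ _
  · refine (hmin r ⟨by simpa using h, hr⟩).trans' ?_
    calc _ ≤ m / (|R| * S + 1) * (|R| * S) := by
          gcongr
          · exact min_le_right _ _
          · exact h.trans (le_abs_self R)
          · exact hS r
      _ ≤ m / (|R| * S + 1) * (|R| * S + 1) := by gcongr; linarith
      _ = m := by field_simp

end Objective

/-! ### Accuracy of the distributed gradient estimate. -/

section ClosedLoop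

variable {n N : ℕ}

/-- Desired joint position relative to the average, for the frame `e` scaled by `ε`. -/
def offset (e : Fin N → Vec n) (ε : ℝ) : State n N := State.mk fun i => ε • e i

/-- Joint saturated estimate. -/
def seek (σ : Vec n → Vec n) (ε : ℝ) (δ : State n N) : State n N :=
  State.mk fun i => σ ((ε ^ 2)⁻¹ • δ i)

/-- Joint input of the averaging algorithm. -/
def source (h : Vec n → ℝ) (e : Fin N → Vec n) (ε : ℝ) (p : State n N) : State n N :=
  State.mk fun i => ((N : ℝ) * h (p i)) • ε • e i

/-- Joint velocity, for the gain `c₀ = ε²`. -/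
def velocity (a : Fin N → Fin N → ℝ) (e : Fin N → Vec n) (σ : Vec n → Vec n) (ε : ℝ)
    (p δ : State n N) : State n N :=
  -(ε ^ 2 • seek σ ε δ) - ((N : ℝ)⁻¹ • laplacian a) (p - offset e ε)

/-- Trajectories of the joint closed-loop system on `(0, ∞)`, with `c₀ = ε²` and `μ = 1`. -/
structure IsTrajectory (a b : Fin N → Fin N → ℝ) (h : Vec n → ℝ) (e : Fin N → Vec n)
    (σ : Vec n → Vec n) (ε : ℝ) (p δ q : ℝ → State n N) : Prop where
  position : ∀ t > 0, HasDerivAt p (velocity a e σ ε (p t) (δ t)) t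
  delta : ∀ t > 0, HasDerivAt δ (-(δ t - source h e ε (p t)) - laplacian b (q t)) t
  q : ∀ t > 0, HasDerivAt q (laplacian b (δ t)) t

theorem mean_offset {e : Fin N → Vec n} (he0 : ∑ i, e i = 0) (ε : ℝ) :
    mean (offset e ε) = 0 := by
  simp [mean_apply, offset, ← Finset.smul_sum, he0]

theorem mean_laplacian (hN : 0 < N) {w : Fin N → Fin N → ℝ} (hw : IsConnectedWeight w)
    (s : State n N) : mean (laplacian w s) = 0 := by
  have := (isLaplacian_laplacian (n := n) hN hw).proj_apply s
  rw [← consensus_apply _ (⟨0, hN⟩ : Fin N), this]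
  rfl

theorem norm_seek_le {σ : Vec n → Vec n} {S : ℝ} (hS : ∀ r, ‖σ r‖ ≤ S) (ε : ℝ)
    (δ : State n N) : ‖seek σ ε δ‖ ≤ N * S :=
  State.norm_le fun _ => hS _

/-- The formation forces cancel in the average, so only the seeking terms move it. -/
theorem mean_velocity (hN : 0 < N) {a : Fin N → Fin N → ℝ} (ha : IsConnectedWeight a)
    (e : Fin N → Vec n) (σ : Vec n → Vec n) (ε : ℝ) (p δ : State n N) :
    mean (velocity a e σ ε p δ) =
      -((ε ^ 2 * (N : ℝ)⁻¹) • ∑ i, σ ((ε ^ 2)⁻¹ • δ i)) := by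
  simp only [velocity, map_sub mean, map_neg, map_smul, smul_apply, mean_laplacian hN ha,
    smul_zero, sub_zero]
  rw [mean_apply, smul_smul]
  rfl

/-- Eventual bounds on the spread of the agents and on their speed, of the order of the gain. -/
theorem eventually_spread_le (hN : 0 < N) {a : Fin N → Fin N → ℝ} (ha : IsConnectedWeight a)
    {σ : Vec n → Vec n} (hσ : IsSaturation σ) {e : Fin N → Vec n} (he0 : ∑ i, e i = 0) :
    ∃ K > 0, ∀ (ε : ℝ) (p δ : ℝ → State n N), 0 < ε →
      (∀ t > 0, HasDerivAt p (velocity a e σ ε (p t) (δ t)) t) →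
      ∀ᶠ t in atTop, (∀ i, ‖p t i - mean (p t) - ε • e i‖ ≤ K * ε ^ 2) ∧
        (∀ i, ‖velocity a e σ ε (p t) (δ t) i‖ ≤ K * ε ^ 2) ∧
        ‖mean (velocity a e σ ε (p t) (δ t))‖ ≤ K * ε ^ 2 := by
  obtain ⟨S₀, hS₀⟩ := hσ.bounded
  set S := max S₀ 1 with hSdef
  have hS : ∀ r, ‖σ r‖ ≤ S := fun r => (hS₀ r).trans (le_max_left _ _)
  have hS1 : 1 ≤ S := le_max_right _ _
  have hNr : (0 : ℝ) < N := by exact_mod_cast hN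
  set A : State n N →L[ℝ] State n N := (N : ℝ)⁻¹ • laplacian a with hA
  have hLap : IsLaplacian A consensus :=
    (isLaplacian_laplacian hN ha).const_smul (inv_pos.2 hNr)
  obtain ⟨K₁, hK₁, hdis⟩ := hLap.eventually_disagreement_le
  set K₂ := N * S + ‖A‖ * (K₁ * (N * S)) with hK₂
  have hK₂0 : 0 < K₂ := by positivity
  set Km := ‖(mean : State n N →L[ℝ] Vec n)‖ with hKm
  refine ⟨K₁ * (N * S) + (1 + Km) * K₂, by positivity, fun ε p δ hε hp => ?_⟩
  have h1 := hdis (fun t => p t - offset e ε) (fun t => -(ε ^ 2 • seek σ ε (δ t)))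
    (ε ^ 2 * (N * S)) (by positivity)
    ((eventually_gt_atTop 0).mono fun t ht => (hp t ht).sub_const _)
    (Eventually.of_forall fun t => by
      rw [norm_neg, norm_smul, Real.norm_of_nonneg (by positivity)]
      gcongr
      exact norm_seek_le hS ε (δ t))
  filter_upwards [h1] with t ht
  have hmean : mean (p t - offset e ε) = mean (p t) := by rw [map_sub, mean_offset he0, sub_zero]
  have hvel : ‖velocity a e σ ε (p t) (δ t)‖ ≤ K₂ * ε ^ 2 := by
    -- The Laplacian sees only the disagreement, which is already known to be of order `ε²`.
    have h2 : velocity a e σ ε (p t) (δ t) = -(ε ^ 2 • seek σ ε (δ t)) -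
        A (p t - offset e ε - consensus (p t - offset e ε)) := by
      rw [map_sub A, hLap.apply_proj, sub_zero]
      rfl
    rw [h2]
    refine (norm_sub_le _ _).trans ?_
    have h3 : ‖-(ε ^ 2 • seek σ ε (δ t))‖ ≤ ε ^ 2 * (N * S) := by
      rw [norm_neg, norm_smul, Real.norm_of_nonneg (by positivity)]
      gcongr
      exact norm_seek_le hS ε (δ t)
    have h4 := (A.le_opNorm (p t - offset e ε - consensus (p t - offset e ε))).trans
      (mul_le_mul_of_nonneg_left ht (norm_nonneg A))
    calc _ ≤ ε ^ 2 * (N * S) + ‖A‖ * (K₁ * (ε ^ 2 * (N * S))) := add_le_add h3 h4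
      _ = _ := by rw [hK₂]; ring
  have hKm0 : 0 ≤ Km := norm_nonneg _
  have hp1 : 0 ≤ K₁ * (N * S) * ε ^ 2 := by positivity
  have hp2 : 0 ≤ K₂ * ε ^ 2 := by positivity
  have hp3 : 0 ≤ Km * (K₂ * ε ^ 2) := by positivity
  refine ⟨fun i => ?_, fun i => ?_, ?_⟩
  · have h2 := (State.norm_coord_le _ i).trans ht
    have h3 : (p t - offset e ε - consensus (p t - offset e ε)) i =
        p t i - mean (p t) - ε • e i := by
      rw [map_sub State.equiv, map_sub State.equiv, Pi.sub_apply, Pi.sub_apply, consensus_apply,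
        hmean, offset, State.mk_apply, sub_right_comm]
    rw [h3] at h2
    linarith
  · have h2 := (State.norm_coord_le _ i).trans hvel
    linarith
  · have h2 := ((mean : State n N →L[ℝ] Vec n).le_opNorm _).trans
      (mul_le_mul_of_nonneg_left hvel hKm0)
    linarith

theorem hasDerivAt_source {h : Vec n → ℝ} {ω ϑ : ℝ} (hh : IsObjective h ω ϑ)
    (e : Fin N → Vec n) (ε : ℝ) {p : ℝ → State n N} {p' : State n N} {t : ℝ}
    (hp : HasDerivAt p p' t) :
    HasDerivAt (fun s => source h e ε (p s))
      (State.mk fun i => ((N : ℝ) * inner ℝ (gradient h (p t i)) (p' i)) • ε • e i) t := by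
  rw [State.hasDerivAt_iff] at hp ⊢
  exact fun i => ((hh.hasDerivAt_comp (hp i)).const_mul (N : ℝ)).smul_const _

/-- The averaged input is the gradient at the average position, up to a relative error of the
order of the size of the formation. -/
theorem norm_mean_source_sub_gradient_le (hN : 0 < N) {h : Vec n → ℝ} {ω ϑ : ℝ}
    (hh : IsObjective h ω ϑ) {e : Fin N → Vec n} (he0 : ∑ i, e i = 0)
    (he : ∀ k l, ∑ i, e i k * e i l = (1 : Matrix (Fin n) (Fin n) ℝ) k l) {E K ε : ℝ}
    (hE : ∀ i, ‖e i‖ ≤ E) (hE0 : 0 ≤ E) (hK : 0 ≤ K) (hε : 0 < ε) (hε1 : ε ≤ 1)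
    {p : State n N} (hp : ∀ i, ‖p i - mean p - ε • e i‖ ≤ K * ε ^ 2) :
    ‖(ε ^ 2)⁻¹ • mean (source h e ε p) - gradient h (mean p)‖ ≤
      N * E * ϑ * (K + (E + K) ^ 2) * ε * (‖mean p‖ + 1) := by
  have hN' : (N : ℝ) ≠ 0 := by positivity
  have hϑ := hh.theta_pos
  set m := mean p with hm
  set g := gradient h m with hg
  set z : Fin N → Vec n := fun i => p i - m - ε • e i with hz
  set η : Fin N → ℝ := fun i => h (p i) - h m - inner ℝ g (p i - m) with hη
  have hw : ∀ i, ‖p i - m‖ ≤ (E + K) * ε := by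
    intro i
    have h1 : p i - m = ε • e i + z i := by simp [hz]
    rw [h1]
    refine (norm_add_le _ _).trans ?_
    rw [norm_smul, Real.norm_of_nonneg hε.le]
    have h2 : K * ε ^ 2 ≤ K * ε := by
      gcongr; exact pow_le_of_le_one hε.le hε1 two_ne_zero
    have h3 : ε * ‖e i‖ ≤ ε * E := by gcongr; exact hE i
    linarith [hp i]
  have hηb : ∀ i, |η i| ≤ ϑ * ((E + K) * ε) ^ 2 := by
    intro i
    have h1 := hh.abs_taylor_le m (p i - m)
    rw [add_sub_cancel] at h1
    refine h1.trans ?_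
    gcongr
    exact hw i
  have hgz : ∀ i, |inner ℝ g (z i)| ≤ ϑ * ‖m‖ * (K * ε ^ 2) := fun i =>
    (abs_real_inner_le_norm _ _).trans
      (mul_le_mul (hh.norm_gradient_le m) (hp i) (norm_nonneg _) (by positivity))
  -- Expand `h (p i)` at `m` with `p i - m = ε • e i + z i`: `h m` drops out because `∑ e i = 0`,
  -- and the linear term gives `g` by the frame identity. The remainders are `O(ε²)`.
  have hsum : mean (source h e ε p) = ε ^ 2 • g + ε • ∑ i, (inner ℝ g (z i) + η i) • e i := by
    have h1 : ∀ i, h (p i) = h m + ε * inner ℝ g (e i) + (inner ℝ g (z i) + η i) := by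
      intro i
      have h2 : inner ℝ g (z i) = inner ℝ g (p i - m) - ε * inner ℝ g (e i) := by
        rw [hz, inner_sub_right, inner_smul_right]
      simp only [hη, h2]
      ring
    have h3 : mean (source h e ε p) = ε • ∑ i, h (p i) • e i := by
      rw [mean_apply, Finset.smul_sum, Finset.smul_sum]
      refine Finset.sum_congr rfl fun i _ => ?_
      simp only [source, State.mk_apply, smul_smul]
      congr 1
      field_simp
    rw [h3, Finset.sum_congr rfl fun i _ => by rw [h1 i, add_smul, add_smul],
      Finset.sum_add_distrib, Finset.sum_add_distrib, ← Finset.smul_sum, he0, smul_zero, zero_add,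
      smul_add]
    congr 1
    simp only [mul_smul]
    rw [← Finset.smul_sum, sum_inner_smul_frame he, smul_smul, sq]
  have hdiff : (ε ^ 2)⁻¹ • mean (source h e ε p) - g =
      ε⁻¹ • ∑ i, (inner ℝ g (z i) + η i) • e i := by
    rw [hsum, smul_add, smul_smul, smul_smul, inv_mul_cancel₀ (by positivity), one_smul,
      add_sub_cancel_left]
    congr 1
    field_simp
  have hnorm : ‖∑ i, (inner ℝ g (z i) + η i) • e i‖ ≤
      ∑ _i : Fin N, (ϑ * ‖m‖ * (K * ε ^ 2) + ϑ * ((E + K) * ε) ^ 2) * E := by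
    refine norm_sum_le_of_le _ fun i _ => ?_
    rw [norm_smul, Real.norm_eq_abs]
    have h1 : |inner ℝ g (z i) + η i| ≤ ϑ * ‖m‖ * (K * ε ^ 2) + ϑ * ((E + K) * ε) ^ 2 :=
      (abs_add_le _ _).trans (add_le_add (hgz i) (hηb i))
    gcongr
    exact hE i
  rw [hdiff, norm_smul, Real.norm_of_nonneg (by positivity)]
  calc _ ≤ ε⁻¹ * ∑ _i : Fin N, (ϑ * ‖m‖ * (K * ε ^ 2) + ϑ * ((E + K) * ε) ^ 2) * E := by gcongr
    _ = N * E * ϑ * (K * ‖m‖ + (E + K) ^ 2 * 1) * ε := by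
        simp only [Finset.sum_const, Finset.card_univ, Fintype.card_fin, nsmul_eq_mul]
        field_simp
    _ ≤ N * E * ϑ * (K * (‖m‖ + 1) + (E + K) ^ 2 * (‖m‖ + 1)) * ε := by
        gcongr
        · linarith
        · linarith [norm_nonneg m]
    _ = _ := by ring

theorem norm_sub_mean_le {e : Fin N → Vec n} {E K ε : ℝ} (hE : ∀ i, ‖e i‖ ≤ E) (hK : 0 ≤ K)
    (hε : 0 < ε) (hε1 : ε ≤ 1) {p : State n N}
    (hp : ∀ i, ‖p i - mean p - ε • e i‖ ≤ K * ε ^ 2) (i : Fin N) : ‖p i - mean p‖ ≤ E + K := by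
  have h1 : ‖p i - mean p‖ ≤ ‖p i - mean p - ε • e i‖ + ‖ε • e i‖ := by
    simpa using norm_add_le (p i - mean p - ε • e i) (ε • e i)
  rw [norm_smul, Real.norm_of_nonneg hε.le] at h1
  have h2 : ε * ‖e i‖ ≤ 1 * E := by gcongr; exact hE i
  have h3 : K * ε ^ 2 ≤ K * 1 := by gcongr; exact pow_le_one₀ hε.le hε1
  linarith [hp i]

/-- The input of the averaging algorithm varies slowly, relative to the distance of the average
position from the minimizer. -/
theorem norm_source_rate_sq_le {h : Vec n → ℝ} {ω ϑ : ℝ} (hh : IsObjective h ω ϑ)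
    {e : Fin N → Vec n} {E K B ε : ℝ} (hE : ∀ i, ‖e i‖ ≤ E) (hE0 : 0 ≤ E) (hK : 0 ≤ K)
    (hB : B = N * (N * (ϑ * (1 + (E + K)) * K) * E)) (hε : 0 < ε) (hε1 : ε ≤ 1) {p v : State n N}
    (hp : ∀ i, ‖p i - mean p - ε • e i‖ ≤ K * ε ^ 2) (hv : ∀ i, ‖v i‖ ≤ K * ε ^ 2) :
    ‖(State.mk fun i => ((N : ℝ) * inner ℝ (gradient h (p i)) (v i)) • ε • e i : State n N)‖ ^ 2 ≤
      2 * (B + 1) ^ 2 * (ε * ε ^ 2) ^ 2 * (‖mean p‖ ^ 2 + 1) := by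
  have hϑ := hh.theta_pos
  have hB0 : 0 ≤ B := by rw [hB]; positivity
  set f' : State n N := State.mk fun i =>
    ((N : ℝ) * inner ℝ (gradient h (p i)) (v i)) • ε • e i with hf'
  have h2 : ∀ i, ‖f' i‖ ≤ N * (ϑ * (1 + (E + K)) * (‖mean p‖ + 1) * (K * ε ^ 2)) * (ε * E) := by
    intro i
    simp only [hf', State.mk_apply, norm_smul, Real.norm_eq_abs, abs_mul, Nat.abs_cast,
      abs_of_pos hε]
    have h3 : ‖gradient h (p i)‖ ≤ ϑ * (1 + (E + K)) * (‖mean p‖ + 1) := by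
      refine (hh.norm_gradient_le _).trans ?_
      rw [mul_assoc]
      refine mul_le_mul_of_nonneg_left ?_ hϑ.le
      have h4 : ‖p i‖ ≤ ‖p i - mean p‖ + ‖mean p‖ := by
        simpa using norm_add_le (p i - mean p) (mean p)
      have h5 := norm_sub_mean_le hE hK hε hε1 hp i
      have h6 : 0 ≤ (E + K) * ‖mean p‖ := by positivity
      linarith
    gcongr
    · exact (abs_real_inner_le_norm _ _).trans
        (mul_le_mul h3 (hv i) (norm_nonneg _) (by positivity))
    · exact hE i
  have h1 : ‖f'‖ ≤ (B + 1) * (ε * ε ^ 2) * (‖mean p‖ + 1) := by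
    calc ‖f'‖ ≤ B * (ε * ε ^ 2) * (‖mean p‖ + 1) := by
          refine (State.norm_le h2).trans (le_of_eq ?_)
          rw [hB]
          ring
      _ ≤ _ := by gcongr; linarith
  calc ‖f'‖ ^ 2 ≤ ((B + 1) * (ε * ε ^ 2) * (‖mean p‖ + 1)) ^ 2 := by gcongr
    _ = (B + 1) ^ 2 * (ε * ε ^ 2) ^ 2 * (‖mean p‖ + 1) ^ 2 := by ring
    _ ≤ (B + 1) ^ 2 * (ε * ε ^ 2) ^ 2 * (2 * (‖mean p‖ ^ 2 + 1)) := by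
        gcongr
        linarith [two_mul_le_add_sq ‖mean p‖ 1, add_sq ‖mean p‖ 1]
    _ = _ := by ring

/-- Extracts a root without a square root in the constant: `K₃ ≥ 1` gives `K₃ ≤ K₃²`. -/
theorem le_of_sq_le_relative {u m Kt B K₃ η : ℝ} (hm : 0 ≤ m) (hKt : 0 ≤ Kt)
    (hK₃ : K₃ = 2 * Kt * (B + 1) ^ 2 + 1) (hη : 0 ≤ η)
    (hu : u ^ 2 ≤ Kt * (2 * (B + 1) ^ 2 * η ^ 2) * (m ^ 2 + 1)) : u ≤ K₃ * η * (m + 1) := by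
  have hK₃1 : 1 ≤ K₃ := by rw [hK₃]; linarith [show 0 ≤ 2 * Kt * (B + 1) ^ 2 by positivity]
  refine abs_le_of_sq_le_sq' (hu.trans ?_) (by positivity) |>.2
  calc Kt * (2 * (B + 1) ^ 2 * η ^ 2) * (m ^ 2 + 1)
      = (2 * Kt * (B + 1) ^ 2) * η ^ 2 * (m ^ 2 + 1) := by ring
    _ ≤ K₃ ^ 2 * η ^ 2 * (m + 1) ^ 2 := by
        gcongr
        · calc 2 * Kt * (B + 1) ^ 2 ≤ K₃ := by rw [hK₃]; linarith
            _ ≤ K₃ ^ 2 := le_self_pow₀ hK₃1 two_ne_zero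
        · linarith [add_sq m 1]
    _ = _ := by ring

theorem norm_scaled_sub_le {δ f g : Vec n} {ε M C₁ C₂ C : ℝ} (hε : 0 < ε) (hM : 0 ≤ M)
    (h1 : ‖δ - f‖ ≤ C₁ * (ε * ε ^ 2) * M) (h2 : ‖(ε ^ 2)⁻¹ • f - g‖ ≤ C₂ * ε * M)
    (hC : C₁ + C₂ ≤ C) : ‖(ε ^ 2)⁻¹ • δ - g‖ ≤ C * ε * M := by
  have h3 : (ε ^ 2)⁻¹ • δ - g = (ε ^ 2)⁻¹ • (δ - f) + ((ε ^ 2)⁻¹ • f - g) := by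
    rw [smul_sub]; abel
  have h4 : (ε ^ 2)⁻¹ * ‖δ - f‖ ≤ C₁ * ε * M := by
    rw [inv_mul_le_iff₀ (by positivity)]
    linarith
  rw [h3]
  refine (norm_add_le _ _).trans ?_
  rw [norm_smul, Real.norm_of_nonneg (by positivity)]
  calc _ ≤ C₁ * ε * M + C₂ * ε * M := add_le_add h4 h2
    _ = (C₁ + C₂) * ε * M := by ring
    _ ≤ _ := by gcongr

/-- Eventual accuracy of the distributed gradient estimate, relative to the distance of the
average position from the minimizer. -/
theorem eventually_estimate_le (hN : 0 < N) {h : Vec n → ℝ} {ω ϑ : ℝ}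
    (hh : IsObjective h ω ϑ) {a b : Fin N → Fin N → ℝ} (ha : IsConnectedWeight a)
    (hb : IsConnectedWeight b) {σ : Vec n → Vec n} (hσ : IsSaturation σ)
    {e : Fin N → Vec n} (he0 : ∑ i, e i = 0)
    (he : ∀ k l, ∑ i, e i k * e i l = (1 : Matrix (Fin n) (Fin n) ℝ) k l) :
    ∃ K > 0, ∃ ε₁ > 0, ∃ G : State n N →L[ℝ] State n N, ∀ ε, 0 < ε → ε ≤ ε₁ →
      ∀ p δ q : ℝ → State n N, IsTrajectory a b h e σ ε p δ q →
      ∀ᶠ t in atTop,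
        (∀ i, ‖(ε ^ 2)⁻¹ • δ t i - gradient h (mean (p t))‖ ≤ K * ε * (‖mean (p t)‖ + 1)) ∧
        (∀ i, ‖p t i - mean (p t)‖ ≤ K) ∧
        ‖q t - consensus (q t) - G (source h e ε (p t))‖ ≤ K * (‖mean (p t)‖ + 1) := by
  obtain ⟨K, hK, hspread⟩ := eventually_spread_le hN ha hσ he0
  obtain ⟨G, lam, hlam, Kt, hKt, htrack⟩ :=
    (isLaplacian_laplacian (n := n) hN hb).eventually_tracking_le
  have hϑ := hh.theta_pos
  set E : ℝ := ∑ i, ‖e i‖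
  have hE0 : 0 ≤ E := Finset.sum_nonneg fun i _ => norm_nonneg _
  have hE : ∀ i, ‖e i‖ ≤ E := fun i =>
    Finset.single_le_sum (f := fun i => ‖e i‖) (fun i _ => norm_nonneg _) (Finset.mem_univ i)
  obtain ⟨B, hB⟩ : ∃ B, B = N * (N * (ϑ * (1 + (E + K)) * K) * E) := ⟨_, rfl⟩
  have hB0 : 0 ≤ B := by rw [hB]; positivity
  obtain ⟨K₃, hK₃⟩ : ∃ K₃, K₃ = 2 * Kt * (B + 1) ^ 2 + 1 := ⟨_, rfl⟩
  have hK₃1 : 1 ≤ K₃ := by rw [hK₃]; linarith [show 0 ≤ 2 * Kt * (B + 1) ^ 2 by positivity]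
  obtain ⟨C, hC0, hC1, hC2, hC3⟩ : ∃ C > 0, K₃ + N * E * ϑ * (K + (E + K) ^ 2) ≤ C ∧
      E + K ≤ C ∧ K₃ ≤ C := by
    have h1 : 0 ≤ N * E * ϑ * (K + (E + K) ^ 2) := by positivity
    have h2 : 0 < E + K := by positivity
    exact ⟨K₃ + N * E * ϑ * (K + (E + K) ^ 2) + (E + K), by positivity, by linarith, by linarith,
      by linarith⟩
  clear_value E
  -- `ε ≤ lam / K` keeps the speed of the average below `lam`, so that `Y = ‖mean p‖²` satisfies `Y'
  -- ≥ -lam (Y + 1)` as the tracking estimate requires.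
  refine ⟨C, hC0, min 1 (lam / K), by positivity, G, fun ε hε hε₁ p δ q htraj => ?_⟩
  have hε1 : ε ≤ 1 := hε₁.trans (min_le_left _ _)
  have hεlam : K * ε ≤ lam := by
    have := hε₁.trans (min_le_right _ _)
    rw [le_div_iff₀ hK] at this
    linarith
  have hε2 : ε ^ 2 ≤ ε := pow_le_of_le_one hε.le hε1 two_ne_zero
  have hKε2 : K * ε ^ 2 ≤ K * ε := by gcongr
  have hsp := hspread ε p δ hε htraj.position
  set f' : ℝ → State n N := fun t => State.mk fun i =>
    ((N : ℝ) * inner ℝ (gradient h (p t i)) (velocity a e σ ε (p t) (δ t) i)) • ε • e i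
  have hf'b : ∀ᶠ t in atTop, ‖f' t‖ ^ 2 ≤ 2 * (B + 1) ^ 2 * (ε * ε ^ 2) ^ 2 *
      (‖mean (p t)‖ ^ 2 + 1) := by
    filter_upwards [hsp] with t ht
    exact norm_source_rate_sq_le hh hE hE0 hK.le hB hε hε1 ht.1 ht.2.1
  have hmd : ∀ t > 0, HasDerivAt (fun s => mean (p s)) (mean (velocity a e σ ε (p t) (δ t))) t :=
    fun t ht => (mean : State n N →L[ℝ] Vec n).hasFDerivAt.comp_hasDerivAt t (htraj.position t ht)
  have htr := htrack δ q (fun t => source h e ε (p t)) f' (fun t => ‖mean (p t)‖ ^ 2)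
    (fun t => 2 * inner ℝ (mean (p t)) (mean (velocity a e σ ε (p t) (δ t))))
    (2 * (B + 1) ^ 2 * (ε * ε ^ 2) ^ 2) (by positivity)
    ((eventually_gt_atTop 0).mono htraj.delta) ((eventually_gt_atTop 0).mono htraj.q)
    ((eventually_gt_atTop 0).mono fun t ht => hasDerivAt_source hh e ε (htraj.position t ht))
    ((eventually_gt_atTop 0).mono fun t ht => (hmd t ht).norm_sq)
    hf'b (fun t => sq_nonneg _) (by
      filter_upwards [hsp] with t ht
      have h1 := (abs_le.1 (abs_real_inner_le_norm (mean (p t))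
        (mean (velocity a e σ ε (p t) (δ t))))).1
      have h2 : ‖mean (p t)‖ * ‖mean (velocity a e σ ε (p t) (δ t))‖ ≤ ‖mean (p t)‖ * lam := by
        gcongr
        exact ht.2.2.trans (hKε2.trans hεlam)
      have h3 : 2 * ‖mean (p t)‖ * lam ≤ (‖mean (p t)‖ ^ 2 + 1) * lam := by
        gcongr
        linarith [two_mul_le_add_sq ‖mean (p t)‖ 1]
      linarith)
  have hroot : ∀ (u : State n N) (t : ℝ), ‖u‖ ^ 2 ≤ Kt * (2 * (B + 1) ^ 2 * (ε * ε ^ 2) ^ 2) *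
      (‖mean (p t)‖ ^ 2 + 1) → ‖u‖ ≤ K₃ * (ε * ε ^ 2) * (‖mean (p t)‖ + 1) := fun u t hu =>
    le_of_sq_le_relative (norm_nonneg _) hKt.le hK₃ (by positivity) hu
  filter_upwards [hsp, htr] with t ht1 ht2
  refine ⟨fun i => ?_, fun i => ?_, ?_⟩
  · have h1 := (State.norm_coord_le _ i).trans (hroot _ t ht2.1)
    rw [map_sub State.equiv, Pi.sub_apply, consensus_apply] at h1
    exact norm_scaled_sub_le hε (by positivity) h1
      (norm_mean_source_sub_gradient_le hN hh he0 he hE hE0 hK.le hε hε1 ht1.1) hC1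
  · exact (norm_sub_mean_le hE hK.le hε hε1 ht1.1 i).trans hC2
  · refine (hroot _ t ht2.2).trans ?_
    gcongr
    have h1 : ε * ε ^ 2 ≤ 1 := mul_le_one₀ hε1 (by positivity) (hε2.trans hε1)
    exact (mul_le_of_le_one_right (by linarith) h1).trans hC3

end ClosedLoop

/-! ### Descent of the objective at the average position, and ultimate bounds. -/

section Convergence

variable {n N : ℕ}

/-- A saturation function turns an estimate with small relative error into a descent direction. -/
theorem IsSaturation.exists_inner_pos_of_near {σ : Vec n → Vec n} (hσ : IsSaturation σ) {ρ : ℝ}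
    (hρ : 0 < ρ) :
    ∃ θ > 0, ∀ g r, ρ ≤ ‖g‖ → ‖r - g‖ ≤ θ * ‖g‖ → 0 < inner ℝ g (σ r) := by
  obtain ⟨κ, hκ, hang⟩ := hσ.angle_of_le_norm (half_pos hρ)
  -- `1 / 2` gives `‖r‖ ≥ ρ / 2` and `‖g‖ ≤ 2 ‖r‖`; then `κ / 4` limits the loss `⟨r - g, σ r⟩` to
  -- half of `⟨r, σ r⟩`.
  refine ⟨min (1 / 2) (κ / 4), by positivity, fun g r hg hr => ?_⟩
  have h1 : ‖r - g‖ ≤ 1 / 2 * ‖g‖ := hr.trans (by gcongr; exact min_le_left _ _)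
  have h2 : ‖r - g‖ ≤ κ / 4 * ‖g‖ := hr.trans (by gcongr; exact min_le_right _ _)
  have h3 : ‖g‖ ≤ ‖r‖ + ‖r - g‖ := by
    have := norm_sub_le r (r - g)
    rwa [sub_sub_cancel] at this
  have h4 : ‖g‖ ≤ 2 * ‖r‖ := by linarith
  have h5 := hang r (by linarith)
  have h6 := hσ.inner_pos r (norm_pos_iff.1 (by linarith))
  have h7 : inner ℝ (r - g) (σ r) ≤ κ / 4 * (2 * ‖r‖) * ‖σ r‖ :=
    (real_inner_le_norm _ _).trans (by
      gcongr
      exact h2.trans (by gcongr))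
  rw [inner_sub_left] at h7
  linarith

/-- On bounded sets the descent rate is uniform. -/
theorem IsSaturation.exists_le_inner_of_near {σ : Vec n → Vec n} (hσ : IsSaturation σ) {ρ θ : ℝ}
    (hpos : ∀ g r, ρ ≤ ‖g‖ → ‖r - g‖ ≤ θ * ‖g‖ → 0 < inner ℝ g (σ r)) (hθ : 0 ≤ θ) (M : ℝ) :
    ∃ m > 0, ∀ g r, ‖g‖ ≤ M → ρ ≤ ‖g‖ → ‖r - g‖ ≤ θ * ‖g‖ → m ≤ inner ℝ g (σ r) := by
  have hc := hσ.locallyLipschitz.continuous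
  have hK : IsCompact ((closedBall (0 : Vec n) M ×ˢ closedBall (0 : Vec n) ((1 + θ) * M)) ∩
      {x : Vec n × Vec n | ρ ≤ ‖x.1‖ ∧ ‖x.2 - x.1‖ ≤ θ * ‖x.1‖}) :=
    ((isCompact_closedBall _ _).prod (isCompact_closedBall _ _)).inter_right
      ((isClosed_le (f := fun _ : Vec n × Vec n => ρ) (g := fun x => ‖x.1‖)
        (by fun_prop) (by fun_prop)).inter
        (isClosed_le (f := fun x : Vec n × Vec n => ‖x.2 - x.1‖) (g := fun x => θ * ‖x.1‖)
          (by fun_prop) (by fun_prop)))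
  obtain ⟨m, hm, hmin⟩ := hK.exists_forall_le' (f := fun x => inner ℝ x.1 (σ x.2)) (by fun_prop)
    (a := 0) (fun x hx => hpos x.1 x.2 hx.2.1 hx.2.2)
  refine ⟨m, hm, fun g r hM hg hr => hmin (g, r) ⟨⟨by simpa using hM, ?_⟩, hg, hr⟩⟩
  have h1 : ‖r‖ ≤ ‖r - g‖ + ‖g‖ := by simpa using norm_add_le (r - g) g
  have h2 : θ * ‖g‖ ≤ θ * M := by gcongr
  simp only [mem_closedBall, dist_zero_right]
  linarith

theorem average_le {N : ℕ} (hN : 0 < N) {f : Fin N → ℝ} {m : ℝ} (hf : ∀ i, m ≤ f i) :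
    m ≤ (N : ℝ)⁻¹ * ∑ i, f i := by
  have hN' : (0 : ℝ) < N := by exact_mod_cast hN
  rw [le_inv_mul_iff₀ hN']
  simpa using Finset.sum_le_sum fun i (_ : i ∈ Finset.univ) => hf i

/-- If the gradient estimates are eventually accurate up to the relative error `θ` outside a small
ball, then the average position eventually stays in a small ball. -/
theorem eventually_mean_le (hN : 0 < N) {h : Vec n → ℝ} {ω ϑ : ℝ} (hh : IsObjective h ω ϑ)
    {a b : Fin N → Fin N → ℝ} (ha : IsConnectedWeight a) {σ : Vec n → Vec n}
    (hσ : IsSaturation σ) {e : Fin N → Vec n} {ε ρ θ pε : ℝ} (hε : 0 < ε) (hθ : 0 < θ)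
    (hρ : 0 < ρ) (hpε : 0 ≤ pε) (hρpε : ϑ * ρ ^ 2 ≤ ω / 4 * pε ^ 2)
    (hpos : ∀ g r, ω * ρ ≤ ‖g‖ → ‖r - g‖ ≤ θ * ‖g‖ → 0 < inner ℝ g (σ r))
    {p δ q : ℝ → State n N} (htraj : IsTrajectory a b h e σ ε p δ q)
    (hest : ∀ᶠ t in atTop, ρ ≤ ‖mean (p t)‖ → ∀ i,
      ‖(ε ^ 2)⁻¹ • δ t i - gradient h (mean (p t))‖ ≤ θ * ‖gradient h (mean (p t))‖) :
    ∀ᶠ t in atTop, ‖mean (p t)‖ ≤ pε := by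
  have hω := hh.omega_pos
  have hϑ := hh.theta_pos
  set V : ℝ → ℝ := fun t => h (mean (p t)) - h 0 with hV
  set V' : ℝ → ℝ := fun t => -(ε ^ 2 * ((N : ℝ)⁻¹ *
    ∑ i, inner ℝ (gradient h (mean (p t))) (σ ((ε ^ 2)⁻¹ • δ t i)))) with hV'
  have hd : ∀ᶠ t in atTop, HasDerivAt V (V' t) t := by
    filter_upwards [eventually_gt_atTop 0] with t ht
    have h1 : HasDerivAt (fun s => mean (p s)) (mean (velocity a e σ ε (p t) (δ t))) t :=
      (mean : State n N →L[ℝ] Vec n).hasFDerivAt.comp_hasDerivAt t (htraj.position t ht)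
    refine ((hh.hasDerivAt_comp h1).sub_const (h 0)).congr_deriv ?_
    rw [mean_velocity hN ha, inner_neg_right, real_inner_smul_right, inner_sum, mul_assoc]
  have hup : ∀ t, ϑ * ρ ^ 2 < V t → ρ ≤ ‖mean (p t)‖ := by
    intro t ht
    by_contra! hlt
    have h1 := hh.sub_le (mean (p t))
    have h2 : ϑ * ‖mean (p t)‖ ^ 2 ≤ ϑ * ρ ^ 2 := by gcongr
    exact absurd ht (not_lt.2 (h1.trans h2))
  have hgrad : ∀ t, ρ ≤ ‖mean (p t)‖ → ω * ρ ≤ ‖gradient h (mean (p t))‖ := fun t ht =>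
    (mul_le_mul_of_nonneg_left ht hω.le).trans (hh.le_norm_gradient _)
  obtain ⟨T, hT⟩ := eventually_atTop.1 (hd.and hest)
  -- the objective value at the average position is bounded
  set M := max (V T) (ϑ * ρ ^ 2) with hM
  have hVM : ∀ t ≥ T, V t ≤ M := fun t ht => le_max_of_deriv_nonpos_above
    (fun s hs => (hT s hs).1) (fun s hs hs' => by
      have h1 := hup s hs'
      have h2 := average_le hN fun i => (hpos _ _ (hgrad s h1) ((hT s hs).2 h1 i)).le
      exact neg_nonpos.2 (mul_nonneg (by positivity) h2)) ht
  have hM0 : 0 ≤ M := le_max_of_le_right (by positivity)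
  have hbound : ∀ t ≥ T, ‖gradient h (mean (p t))‖ ≤ ϑ * (4 * M / ω + 1) := by
    intro t ht
    refine (hh.norm_gradient_le _).trans (mul_le_mul_of_nonneg_left ?_ hϑ.le)
    have h1 : ω / 4 * ‖mean (p t)‖ ^ 2 ≤ M := (hh.le_sub _).trans (hVM t ht)
    have h2 : ‖mean (p t)‖ ^ 2 ≤ 4 * M / ω := by
      rw [le_div_iff₀ hω]; linarith
    linarith [two_mul_le_add_sq ‖mean (p t)‖ 1, sq_nonneg ‖mean (p t)‖]
  -- A uniform descent rate is available only for bounded gradients, hence the preliminary bound on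
  -- `V`.
  obtain ⟨m, hm, hmin⟩ := hσ.exists_le_inner_of_near hpos hθ.le (ϑ * (4 * M / ω + 1))
  have hfin := eventually_le_of_deriv_neg_above (v₀ := ϑ * ρ ^ 2) (m := ε ^ 2 * m) (by positivity)
    hd (by
      filter_upwards [eventually_ge_atTop T] with t ht ht'
      have h1 := hup t ht'
      have h2 := average_le hN fun i =>
        hmin _ _ (hbound t ht) (hgrad t h1) ((hT t ht).2 h1 i)
      exact neg_le_neg (mul_le_mul_of_nonneg_left h2 (by positivity)))
  filter_upwards [hfin] with t ht
  have h1 : ω / 4 * ‖mean (p t)‖ ^ 2 ≤ ω / 4 * pε ^ 2 := ((hh.le_sub _).trans ht).trans hρpε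
  exact abs_le_of_sq_le_sq' (le_of_mul_le_mul_left h1 (by positivity)) hpε |>.2

/-- The average of `q` is conserved, which supplies the component of `q` that the tracking estimate
does not control. Time 1 is an arbitrary positive reference. -/
theorem consensus_eq_of_one_le (hN : 0 < N) {b : Fin N → Fin N → ℝ} (hb : IsConnectedWeight b)
    {δ q : ℝ → State n N} (hq : ∀ t > 0, HasDerivAt q (laplacian b (δ t)) t) {t : ℝ}
    (ht : 1 ≤ t) : consensus (q t) = consensus (q 1) := by
  have h1 : ∀ s ∈ Ici (1 : ℝ), HasDerivWithinAt (fun s => consensus (q s)) 0 (Ici 1) s := by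
    intro s hs
    have h2 := (consensus : State n N →L[ℝ] State n N).hasFDerivAt.comp_hasDerivAt s
      (hq s (zero_lt_one.trans_le hs))
    rw [(isLaplacian_laplacian hN hb).proj_apply] at h2
    exact h2.hasDerivWithinAt
  have h3 := (convex_Ici (1 : ℝ)).norm_image_sub_le_of_norm_hasDerivWithin_le (C := 0) h1
    (fun _ _ => by simp) (self_mem_Ici) ht
  rw [zero_mul] at h3
  exact sub_eq_zero.1 (norm_le_zero_iff.1 h3)

theorem locallyLipschitz_pi {X ι Y : Type*} [PseudoEMetricSpace X] [Fintype ι]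
    [PseudoEMetricSpace Y] {f : X → ι → Y} (hf : ∀ i, LocallyLipschitz fun x => f x i) :
    LocallyLipschitz f := by
  intro x
  choose K t ht hK using fun i => hf i x
  refine ⟨∑ i, K i, ⋂ i, t i, Filter.iInter_mem.2 ht, fun y hy z hz => ?_⟩
  rw [edist_pi_le_iff]
  intro i
  refine (hK i (mem_iInter.1 hy i) (mem_iInter.1 hz i)).trans ?_
  gcongr
  exact Finset.single_le_sum (f := K) (fun _ _ => zero_le) (Finset.mem_univ i)

theorem State.locallyLipschitz_mk {X : Type*} [PseudoEMetricSpace X] {f : X → Fin N → Vec n}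
    (hf : ∀ i, LocallyLipschitz fun x => f x i) :
    LocallyLipschitz fun x => (State.mk (f x) : State n N) :=
  (State.equiv (n := n) (N := N)).symm.lipschitz.locallyLipschitz.comp (locallyLipschitz_pi hf)

theorem locallyLipschitz_seek {σ : Vec n → Vec n} (hσ : IsSaturation σ) (ε : ℝ) :
    LocallyLipschitz (seek σ ε : State n N → State n N) :=
  State.locallyLipschitz_mk fun i => hσ.locallyLipschitz.comp
    ((ε ^ 2)⁻¹ • State.coord i : State n N →L[ℝ] Vec n).lipschitz.locallyLipschitz

theorem locallyLipschitz_source {h : Vec n → ℝ} {ω ϑ : ℝ} (hh : IsObjective h ω ϑ)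
    (e : Fin N → Vec n) (ε : ℝ) : LocallyLipschitz (source h e ε : State n N → State n N) :=
  State.locallyLipschitz_mk fun i => locallyLipschitz_smul
    ((locallyLipschitz_smul (.const (N : ℝ)) hh.contDiff.locallyLipschitz).comp
      (State.coord i : State n N →L[ℝ] Vec n).lipschitz.locallyLipschitz) (.const _)

/-- Main estimate: for a small formation, every trajectory is eventually bounded and its average
position is ultimately in the prescribed ball. -/
theorem exists_scale (hN : 0 < N) {h : Vec n → ℝ} {ω ϑ : ℝ} (hh : IsObjective h ω ϑ)
    {a b : Fin N → Fin N → ℝ} (ha : IsConnectedWeight a) (hb : IsConnectedWeight b)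
    {σ : Vec n → Vec n} (hσ : IsSaturation σ) {e : Fin N → Vec n} (he0 : ∑ i, e i = 0)
    (he : ∀ k l, ∑ i, e i k * e i l = (1 : Matrix (Fin n) (Fin n) ℝ) k l)
    {pε : ℝ} (hpε : 0 < pε) :
    ∃ ε > 0, ∀ p δ q : ℝ → State n N, IsTrajectory a b h e σ ε p δ q →
      (∀ᶠ t in atTop, ‖mean (p t)‖ ≤ pε) ∧
      ∃ M, ∀ᶠ t in atTop, ‖p t‖ ≤ M ∧ ‖δ t‖ ≤ M ∧ ‖q t‖ ≤ M := by
  obtain ⟨K, hK, ε₁, hε₁, G, hest⟩ := eventually_estimate_le hN hh ha hb hσ he0 he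
  have hω := hh.omega_pos
  have hϑ := hh.theta_pos
  -- Chosen so that `h - h 0 ≤ ϑ ρ²`, with `ρ = pε * s`, confines the average to the ball of radius
  -- `pε`.
  set s : ℝ := min 1 (ω / (4 * ϑ)) with hs
  have hs0 : 0 < s := by positivity
  have hs1 : s ≤ 1 := min_le_left _ _
  have hs2 : s ^ 2 ≤ ω / (4 * ϑ) := (pow_le_of_le_one hs0.le hs1 two_ne_zero).trans (min_le_right _ _)
  set ρ : ℝ := pε * s with hρdef
  have hρ : 0 < ρ := by positivity
  have hρpε : ϑ * ρ ^ 2 ≤ ω / 4 * pε ^ 2 := by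
    calc ϑ * ρ ^ 2 = ϑ * pε ^ 2 * s ^ 2 := by rw [hρdef]; ring
      _ ≤ ϑ * pε ^ 2 * (ω / (4 * ϑ)) := by gcongr
      _ = _ := by field_simp
  obtain ⟨θ, hθ, hpos⟩ := hσ.exists_inner_pos_of_near (show 0 < ω * ρ by positivity)
  have hε₂ : 0 < θ * ω / (K * (1 + 1 / ρ)) := by positivity
  -- For `‖mean p‖ ≥ ρ` one has `‖mean p‖ + 1 ≤ (1 + 1 / ρ) ‖mean p‖`, so this `ε` turns the
  -- estimation error into at most `θ` times the gradient norm.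
  refine ⟨min ε₁ (θ * ω / (K * (1 + 1 / ρ))), by positivity, fun p δ q htraj => ?_⟩
  set ε := min ε₁ (θ * ω / (K * (1 + 1 / ρ))) with hεdef
  have hε : 0 < ε := by positivity
  have hεb : K * ε * (1 + 1 / ρ) ≤ θ * ω := by
    have h1 : ε ≤ θ * ω / (K * (1 + 1 / ρ)) := min_le_right _ _
    rw [le_div_iff₀ (by positivity)] at h1
    linarith
  have hE := hest ε hε (min_le_left _ _) p δ q htraj
  have hmean : ∀ᶠ t in atTop, ‖mean (p t)‖ ≤ pε := by
    refine eventually_mean_le hN hh ha hσ hε hθ hρ hpε.le hρpε hpos htraj ?_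
    filter_upwards [hE] with t ht hm i
    refine (ht.1 i).trans ?_
    have h1 : ‖mean (p t)‖ + 1 ≤ (1 + 1 / ρ) * ‖mean (p t)‖ := by
      have : 1 ≤ 1 / ρ * ‖mean (p t)‖ := by
        rw [one_div, le_inv_mul_iff₀ hρ]; linarith
      linarith
    calc K * ε * (‖mean (p t)‖ + 1) ≤ K * ε * ((1 + 1 / ρ) * ‖mean (p t)‖) := by gcongr
      _ = K * ε * (1 + 1 / ρ) * ‖mean (p t)‖ := by ring
      _ ≤ θ * ω * ‖mean (p t)‖ := by gcongr
      _ = θ * (ω * ‖mean (p t)‖) := by ring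
      _ ≤ _ := by gcongr; exact hh.le_norm_gradient _
  refine ⟨hmean, ?_⟩
  have hproper : ProperSpace (State n N) := FiniteDimensional.proper ℝ _
  set Mp : ℝ := N * (K + pε) with hMp
  set Mδ : ℝ := N * (ε ^ 2 * (K * ε * (pε + 1) + ϑ * pε)) with hMδ
  obtain ⟨C, hC⟩ := (isCompact_closedBall (0 : State n N) Mp).exists_bound_of_continuousOn
    ((G.continuous.comp (locallyLipschitz_source hh e ε).continuous).continuousOn)
  set Mq : ℝ := K * (pε + 1) + C + ‖consensus (q 1)‖ with hMq
  refine ⟨max Mp (max Mδ Mq), ?_⟩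
  filter_upwards [hE, hmean, eventually_ge_atTop 1] with t h1 h2 h3
  have hpt : ‖p t‖ ≤ Mp := State.norm_le fun i => by
    have h4 : ‖p t i‖ ≤ ‖p t i - mean (p t)‖ + ‖mean (p t)‖ := by
      simpa using norm_add_le (p t i - mean (p t)) (mean (p t))
    linarith [h1.2.1 i]
  refine ⟨hpt.trans (le_max_left _ _), le_max_of_le_right (le_max_of_le_left ?_),
    le_max_of_le_right (le_max_of_le_right ?_)⟩
  · refine State.norm_le fun i => ?_
    have h4 : ‖(ε ^ 2)⁻¹ • δ t i‖ ≤ K * ε * (pε + 1) + ϑ * pε := by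
      have h5 : ‖(ε ^ 2)⁻¹ • δ t i‖ ≤
          ‖(ε ^ 2)⁻¹ • δ t i - gradient h (mean (p t))‖ + ‖gradient h (mean (p t))‖ := by
        simpa using norm_add_le ((ε ^ 2)⁻¹ • δ t i - gradient h (mean (p t)))
          (gradient h (mean (p t)))
      refine h5.trans (add_le_add ((h1.1 i).trans ?_) ((hh.norm_gradient_le _).trans ?_))
      · gcongr
      · gcongr
    rw [norm_smul, Real.norm_of_nonneg (by positivity), inv_mul_le_iff₀ (by positivity)] at h4
    exact h4
  · have h4 : q t = (q t - consensus (q t) - G (source h e ε (p t))) + G (source h e ε (p t)) +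
        consensus (q t) := by abel
    rw [h4]
    refine (norm_add₃_le).trans (add_le_add (add_le_add (h1.2.2.trans ?_) ?_) ?_)
    · gcongr
    · exact hC _ (by simpa using hpt)
    · rw [consensus_eq_of_one_le hN hb htraj.q h3]

end Convergence

/-! ### Existence of closed-loop solutions and passage to joint states. -/

section Solutions

variable {n N : ℕ}

/-- The a priori bounds come in cascade. As `σ` is bounded, Grönwall bounds `p` whatever `δ` and `q`
do; on that ball `source` is bounded, and a second Grönwall bounds `(δ, q)`. Thus the growth of `h`
cannot cause blow-up. -/
theorem exists_joint_solution {h : Vec n → ℝ} {ω ϑ : ℝ} (hh : IsObjective h ω ϑ)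
    (a b : Fin N → Fin N → ℝ) {σ : Vec n → Vec n} (hσ : IsSaturation σ) (e : Fin N → Vec n)
    (ε : ℝ) (p₀ δ₀ q₀ : State n N) :
    ∃ p δ q : ℝ → State n N, (∀ t, 0 ≤ t →
      HasDerivWithinAt p (velocity a e σ ε (p t) (δ t)) (Ici 0) t ∧
      HasDerivWithinAt δ (-(δ t - source h e ε (p t)) - laplacian b (q t)) (Ici 0) t ∧
      HasDerivWithinAt q (laplacian b (δ t)) (Ici 0) t) ∧ p 0 = p₀ ∧ δ 0 = δ₀ ∧ q 0 = q₀ := by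
  set X := State n N × State n N × State n N
  set A : State n N →L[ℝ] State n N := (N : ℝ)⁻¹ • laplacian a with hA
  set L : State n N →L[ℝ] State n N := laplacian b with hL
  set F : X → X := fun x => (velocity a e σ ε x.1 x.2.1,
    -(x.2.1 - source h e ε x.1) - L x.2.2, L x.2.1) with hF
  have hproper : ProperSpace (State n N) := FiniteDimensional.proper ℝ _
  have l1 : LocallyLipschitz fun x : X => x.1 := LipschitzWith.prod_fst.locallyLipschitz
  have l2 : LocallyLipschitz fun x : X => x.2.1 :=
    (LipschitzWith.prod_fst.comp LipschitzWith.prod_snd).locallyLipschitz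
  have l3 : LocallyLipschitz fun x : X => x.2.2 :=
    (LipschitzWith.prod_snd.comp LipschitzWith.prod_snd).locallyLipschitz
  have hFL : LocallyLipschitz F := by
    refine .prodMk ?_ (.prodMk ?_ (L.lipschitz.locallyLipschitz.comp l2))
    · exact (locallyLipschitz_smul (.const (ε ^ 2)) ((locallyLipschitz_seek hσ ε).comp l2)).neg.sub
        (A.lipschitz.locallyLipschitz.comp (l1.sub (.const (offset e ε))))
    · exact (l2.sub ((locallyLipschitz_source hh e ε).comp l1)).neg.sub
        (L.lipschitz.locallyLipschitz.comp l3)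
  obtain ⟨S, hS⟩ := hσ.bounded
  have hS0 : 0 ≤ S := (norm_nonneg _).trans (hS 0)
  obtain ⟨α, hα0, hα⟩ := exists_solution_Ici hFL (p₀, δ₀, q₀) fun T hT => by
    set cp : ℝ := ε ^ 2 * (N * S) + ‖A‖ * ‖offset e ε‖ with hcp
    have hcp0 : 0 ≤ cp := by positivity
    set Rp : ℝ := gronwallBound ‖p₀‖ ‖A‖ cp T with hRp
    obtain ⟨C, hC⟩ := (isCompact_closedBall (0 : State n N) Rp).exists_bound_of_continuousOn
      (locallyLipschitz_source hh e ε).continuous.continuousOn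
    set Rq : ℝ := gronwallBound ‖(δ₀, q₀)‖ (1 + ‖L‖) (max C 0) T with hRq
    refine exists_solution_Icc hFL _ hT (R := max Rp Rq) fun τ hτ0 hτT α hα0 hα => ?_
    have hcont : ContinuousOn α (Icc 0 τ) := fun t ht => (hα t ht).continuousWithinAt
    have hα' : ∀ t ∈ Ico 0 τ, HasDerivWithinAt α (F (α t)) (Ici t) t := fun t ht =>
      (hα t ⟨ht.1, ht.2.le⟩).mono_of_mem_nhdsWithin
        (mem_of_superset (Icc_mem_nhdsGE ht.2) (Icc_subset_Icc_left ht.1))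
    have hp : ∀ t ∈ Icc 0 τ, ‖(α t).1‖ ≤ Rp := by
      intro t ht
      have h1 := norm_le_gronwallBound_of_norm_deriv_right_le (f := fun t => (α t).1)
        (f' := fun t => (F (α t)).1) (δ := ‖p₀‖) (K := ‖A‖) (ε := cp) (a := 0) (b := τ)
        (continuous_fst.comp_continuousOn hcont)
        (fun t ht => (ContinuousLinearMap.fst ℝ (State n N) (State n N × State n N)).hasFDerivAt
          |>.comp_hasDerivWithinAt t (hα' t ht)) (by simp [hα0]) (by
          intro t _
          have h2 : ‖ε ^ 2 • seek σ ε (α t).2.1‖ ≤ ε ^ 2 * (N * S) := by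
            rw [norm_smul, Real.norm_of_nonneg (by positivity)]
            gcongr
            exact norm_seek_le hS ε _
          have h3 : ‖A ((α t).1 - offset e ε)‖ ≤ ‖A‖ * (‖(α t).1‖ + ‖offset e ε‖) :=
            (A.le_opNorm _).trans (by gcongr; exact norm_sub_le _ _)
          have h4 := norm_sub_le (-(ε ^ 2 • seek σ ε (α t).2.1)) (A ((α t).1 - offset e ε))
          rw [norm_neg] at h4
          calc _ ≤ _ := h4
            _ ≤ ε ^ 2 * (N * S) + ‖A‖ * (‖(α t).1‖ + ‖offset e ε‖) := add_le_add h2 h3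
            _ = _ := by rw [hcp]; ring) t ht
      rw [sub_zero] at h1
      exact h1.trans (gronwallBound_mono (norm_nonneg _) hcp0 (norm_nonneg _) (ht.2.trans hτT))
    have hq : ‖(α τ).2‖ ≤ Rq := by
      have h1 := norm_le_gronwallBound_of_norm_deriv_right_le (f := fun t => (α t).2)
        (f' := fun t => (F (α t)).2) (δ := ‖(δ₀, q₀)‖) (K := 1 + ‖L‖) (ε := max C 0) (a := 0)
        (b := τ) (continuous_snd.comp_continuousOn hcont)
        (fun t ht => (ContinuousLinearMap.snd ℝ (State n N) (State n N × State n N)).hasFDerivAt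
          |>.comp_hasDerivWithinAt t (hα' t ht)) (by simp [hα0]) (by
          intro t ht
          have h2 := hC (α t).1 (by simpa using hp t ⟨ht.1, ht.2.le⟩)
          have h3 : ‖(α t).2.1‖ ≤ ‖(α t).2‖ := norm_fst_le _
          have h4 : ‖L (α t).2.2‖ ≤ ‖L‖ * ‖(α t).2‖ :=
            (L.le_opNorm _).trans (by gcongr; exact norm_snd_le _)
          have h5 : ‖L (α t).2.1‖ ≤ ‖L‖ * ‖(α t).2‖ := (L.le_opNorm _).trans (by gcongr)
          have h6 := le_max_left C 0
          have h7 := le_max_right C 0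
          have h8 := norm_nonneg (α t).2
          refine max_le ?_ ?_
          · have h9 := norm_sub_le (-((α t).2.1 - source h e ε (α t).1)) (L (α t).2.2)
            rw [norm_neg] at h9
            have h10 := norm_sub_le (α t).2.1 (source h e ε (α t).1)
            calc _ ≤ _ := h9
              _ ≤ _ := by linarith
          · calc _ ≤ _ := h5
              _ ≤ _ := by linarith) τ ⟨hτ0, le_rfl⟩
      rw [sub_zero] at h1
      exact h1.trans (gronwallBound_mono (norm_nonneg _) (le_max_right _ _) (by positivity) hτT)
    exact max_le_max (hp τ ⟨hτ0, le_rfl⟩) hq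
  refine ⟨fun t => (α t).1, fun t => (α t).2.1, fun t => (α t).2.2, fun t ht => ⟨?_, ?_, ?_⟩,
    by simp [hα0], by simp [hα0], by simp [hα0]⟩
  · exact (ContinuousLinearMap.fst ℝ (State n N) (State n N × State n N)).hasFDerivAt
      |>.comp_hasDerivWithinAt t (hα t ht)
  · exact ((ContinuousLinearMap.fst ℝ (State n N) (State n N)).comp
      (ContinuousLinearMap.snd ℝ (State n N) (State n N × State n N))).hasFDerivAt
      |>.comp_hasDerivWithinAt t (hα t ht)
  · exact ((ContinuousLinearMap.snd ℝ (State n N) (State n N)).comp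
      (ContinuousLinearMap.snd ℝ (State n N) (State n N × State n N))).hasFDerivAt
      |>.comp_hasDerivWithinAt t (hα t ht)

/-- The closed-loop system, written for joint states. -/
theorem isSolution_iff (hN : 0 < N) {e : Fin N → Vec n} (he0 : ∑ i, e i = 0)
    (he : ∀ k l, ∑ i, e i k * e i l = (1 : Matrix (Fin n) (Fin n) ℝ) k l) {ε : ℝ} (hε : 0 < ε)
    (a b : Fin N → Fin N → ℝ) (σ : Vec n → Vec n) (h : Vec n → ℝ)
    (p δ q : ℝ → Fin N → Vec n) :
    (Controller.mk a b (fun i j => ε • (e i - e j)) σ (ε ^ 2) 1).IsSolution h p δ q ↔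
      ∀ t, 0 ≤ t →
        HasDerivWithinAt (fun s => State.mk (p s))
          (velocity a e σ ε (State.mk (p t)) (State.mk (δ t))) (Ici 0) t ∧
        HasDerivWithinAt (fun s => State.mk (δ s))
          (-(State.mk (δ t) - source h e ε (State.mk (p t))) - laplacian b (State.mk (q t)))
          (Ici 0) t ∧
        HasDerivWithinAt (fun s => State.mk (q s)) (laplacian b (State.mk (δ t))) (Ici 0) t := by
  have e1 : ∀ t i, velocity a e σ ε (State.mk (p t)) (State.mk (δ t)) i =
      (Controller.mk a b (fun i j => ε • (e i - e j)) σ (ε ^ 2) 1).seekingVelocity (δ t) i +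
      (Controller.mk a b (fun i j => ε • (e i - e j)) σ (ε ^ 2) 1).formationVelocity (p t) i := by
    intro t i
    simp only [velocity, Controller.seekingVelocity, Controller.formationVelocity,
      toLp_inv_formationMatrix_mulVec hN he0 he hε, map_sub State.equiv, map_neg, map_smul,
      smul_apply, Pi.sub_apply, Pi.neg_apply, Pi.smul_apply, seek, offset,
      laplacian_apply, State.mk_apply]
    congr 4
    funext j
    congr 1
    rw [smul_sub]
    abel
  have e2 : ∀ t i, (-(State.mk (δ t) - source h e ε (State.mk (p t))) -
      laplacian b (State.mk (q t)) : State n N) i =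
      (Controller.mk a b (fun i j => ε • (e i - e j)) σ (ε ^ 2) 1).deltaRate h
        (p t) (δ t) (q t) i := by
    intro t i
    simp only [Controller.deltaRate, relCenter_scaled hN he0, map_sub State.equiv, map_neg,
      Pi.sub_apply, Pi.neg_apply, source, laplacian_apply, State.mk_apply]
  have e3 : ∀ t i, laplacian b (State.mk (δ t)) i =
      (Controller.mk a b (fun i j => ε • (e i - e j)) σ (ε ^ 2) 1).qRate (δ t) i := by
    intro t i
    simp only [Controller.qRate, laplacian_apply, State.mk_apply, one_smul]
  simp only [State.hasDerivWithinAt_iff, State.mk_apply, e1, e2, e3]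
  exact ⟨fun hs t ht => ⟨hs.position t ht, hs.delta t ht, hs.q t ht⟩,
    fun hs => ⟨fun t ht => (hs t ht).1, fun t ht => (hs t ht).2.1, fun t ht => (hs t ht).2.2⟩⟩

end Solutions

end SourceSeeking

end

/-! ### Assembly of the theorem. -/

theorem theorem7 {n N : ℕ} (hN : n + 1 ≤ N)
    (h : SourceSeeking.Vec n → ℝ) (ω ϑ : ℝ) (hh : SourceSeeking.IsObjective h ω ϑ)
    (a b : Fin N → Fin N → ℝ)
    (ha : SourceSeeking.IsConnectedWeight a) (hb : SourceSeeking.IsConnectedWeight b)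
    (σ : SourceSeeking.Vec n → SourceSeeking.Vec n) (hσ : SourceSeeking.IsSaturation σ)
    (pε : ℝ) (hpε : 0 < pε) :
    ∃ (d : Fin N → Fin N → SourceSeeking.Vec n) (c₀ μ : ℝ),
      SourceSeeking.IsFormation d ∧ 0 < c₀ ∧ 0 < μ ∧
      -- from every initial state there is a closed-loop solution for all times
      (∀ pInit δInit qInit : Fin N → SourceSeeking.Vec n,
        ∃ p δ q : ℝ → Fin N → SourceSeeking.Vec n,
          (SourceSeeking.Controller.mk a b d σ c₀ μ).IsSolution h p δ q ∧
          p 0 = pInit ∧ δ 0 = δInit ∧ q 0 = qInit) ∧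
      -- along every closed-loop solution, all states stay bounded and the average position
      -- is ultimately in the prescribed ball
      (∀ p δ q : ℝ → Fin N → SourceSeeking.Vec n,
        (SourceSeeking.Controller.mk a b d σ c₀ μ).IsSolution h p δ q →
          (∃ B : ℝ, ∀ t, 0 ≤ t → ∀ i, ‖p t i‖ ≤ B ∧ ‖δ t i‖ ≤ B ∧ ‖q t i‖ ≤ B) ∧
          (∀ᶠ t in Filter.atTop, ‖SourceSeeking.averagePosition (p t)‖ ≤ pε)) := by
  have hN0 : 0 < N := by omega
  obtain ⟨e, he0, he⟩ := SourceSeeking.exists_centered_frame hN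
  obtain ⟨ε, hε, hmain⟩ := SourceSeeking.exists_scale hN0 hh ha hb hσ he0 he hpε
  refine ⟨fun i j => ε • (e i - e j), ε ^ 2, 1, SourceSeeking.isFormation_scaled hN0 he0 he hε,
    by positivity, one_pos, fun p₀ δ₀ q₀ => ?_, fun p δ q hsol => ?_⟩
  · obtain ⟨p, δ, q, hsol, hp0, hδ0, hq0⟩ := SourceSeeking.exists_joint_solution hh a b hσ e ε
      (.mk p₀) (.mk δ₀) (.mk q₀)
    have hmk : ∀ s : SourceSeeking.State n N, SourceSeeking.State.mk (fun i => s i) = s :=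
      fun s => SourceSeeking.State.ext fun i => by simp
    refine ⟨fun t i => p t i, fun t i => δ t i, fun t i => q t i, ?_, ?_, ?_, ?_⟩
    · rw [SourceSeeking.isSolution_iff hN0 he0 he hε]
      simpa only [hmk] using hsol
    · funext i; simp [hp0]
    · funext i; simp [hδ0]
    · funext i; simp [hq0]
  · rw [SourceSeeking.isSolution_iff hN0 he0 he hε] at hsol
    have htraj : SourceSeeking.IsTrajectory a b h e σ ε (fun t => .mk (p t)) (fun t => .mk (δ t))
        (fun t => .mk (q t)) :=
      ⟨fun t ht => (hsol t ht.le).1.hasDerivAt (Ici_mem_nhds ht),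
        fun t ht => (hsol t ht.le).2.1.hasDerivAt (Ici_mem_nhds ht),
        fun t ht => (hsol t ht.le).2.2.hasDerivAt (Ici_mem_nhds ht)⟩
    obtain ⟨hmean, M, hM⟩ := hmain _ _ _ htraj
    -- The bounds so far hold only for large times; continuity on `[0, ∞)` covers the compact
    -- initial interval.
    have hbd : ∀ u : ℝ → Fin N → SourceSeeking.Vec n,
        ContinuousOn (fun t => (SourceSeeking.State.mk (u t) : SourceSeeking.State n N))
          (Set.Ici 0) →
        (∀ᶠ t in Filter.atTop, ‖(SourceSeeking.State.mk (u t) : SourceSeeking.State n N)‖ ≤ M) →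
        ∃ B : ℝ, ∀ t, 0 ≤ t → ∀ i, ‖u t i‖ ≤ B := by
      intro u hu huM
      obtain ⟨B, hB⟩ := SourceSeeking.exists_bound_of_eventually_bound hu huM
      exact ⟨B, fun t ht i => by
        simpa using (SourceSeeking.State.norm_coord_le _ i).trans (hB t ht)⟩
    obtain ⟨B₁, hB₁⟩ := hbd p (fun t ht => (hsol t ht).1.continuousWithinAt)
      (hM.mono fun t ht => ht.1)
    obtain ⟨B₂, hB₂⟩ := hbd δ (fun t ht => (hsol t ht).2.1.continuousWithinAt)
      (hM.mono fun t ht => ht.2.1)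
    obtain ⟨B₃, hB₃⟩ := hbd q (fun t ht => (hsol t ht).2.2.continuousWithinAt)
      (hM.mono fun t ht => ht.2.2)
    refine ⟨⟨max B₁ (max B₂ B₃), fun t ht i => ⟨(hB₁ t ht i).trans (le_max_left _ _),
      (hB₂ t ht i).trans ((le_max_left _ _).trans (le_max_right _ _)),
      (hB₃ t ht i).trans ((le_max_right _ _).trans (le_max_right _ _))⟩⟩, ?_⟩
    filter_upwards [hmean] with t ht
    simpa [SourceSeeking.averagePosition, SourceSeeking.mean_apply] using ht
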